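/- **Game.** Two players compete for a prize worth $1$ in a two-stage all-pay auction. In stage 1 the players simultaneously choose bids $b_{i1}\in[0,1]$. Under *Rank feedback* each player then learns only whether he is ranked first (signal $[0,b_{i1}]$, containing the opponent's bid $b_{-i1}$) or second (signal $[b_{i1},1]$); one player is ranked first and the other second, the higher bid first, a tie being broken by a fair coin. In stage 2 the players simultaneously choose further bids $b_{i2}\in[0,\infty)$. The player with the higher total bid $b_i=b_{i1}+b_{i2}$ wins (a tie is broken by a fair coin), and each player pays his total bid. **Strategies and beliefs.** A strategy $\beta_i=(\beta_{i1},\beta_{i2})$ consists of a distribution $\beta_{i1}$ on $[0,1]$ and, for each information set (own stage-1 bid $b_{i1}$, own signal $S$), a distribution $\beta_{i2}(b_{i1},S)$ of $b_{i2}$, depending measurably on the information set. It is *pure* if $\beta_{i1}$ is a point mass (stage-2 bids may be random). A belief $\mu_i$ assigns to each information set a distribution on $[0,1]$ of the opponent's stage-1 bid. **Sequential equilibrium.** An assessment $(\beta,\mu)$ is a sequential equilibrium if 1. (sequential rationality) $\beta_i$ maximizes player $i$'s ex ante expected utility against $\beta_{-i}$ over all strategies, and at every information set $(b_{i1},S)$,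 except $(1,[1,1])$ reached by a player who bids $1$ and is ranked second, $\beta_{i2}(b_{i1},S)$ maximizes his expected continuation utility given $\mu_i(b_{i1},S)$ and $\beta_{-i}$; 2. (Bayes) $\mu_i(b_{i1},S)$ is given by Bayes' rule from $\beta_{-i1}$ whenever the signal $S$ has positive probability given player $i$'s own bid $b_{i1}$ and $\beta_{-i1}$; 3. (consistency) $(\beta,\mu)$ is the limit, weakly at every information set, of a sequence of completely mixed strategy profiles (full support in both stages, and every signal having positive probability after every own bid) together with the beliefs that Bayes' rule derives from them. (A player at the exempted information set knows that his opponent's total bid is at least $1$; if it equals $1$, he has no best response.) **Proposition.** Under Rank feedback, every pure-strategy sequential equilibrium $(\beta,\mu)$ satisfies $\beta_{11}=\beta_{21}=\delta_0$, and on path the total bid $b_i$ of each player $i$ is uniform on $(0,1]$, both unconditionally and conditionally on either signal received on path. Moreover, for every $\varepsilon>0$ there is a pure-strategy sequential equilibrium such that, for each player $i$: * the beliefs are, for every $b_{i1}\in[0,1]$, $\mu_i(b_{i1},[0,b_{i1}])=\delta_0$ (ranked first) and $\mu_i(b_{i1},[b_{i1},1])=\delta_{b_{i1}}$ (ranked second);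 * $\beta_{i1}=\delta_0$; * after any $b_{i1}\in[0,1]$ and being ranked first, $b_i=b_{i1}$ with probability $b_{i1}$, and otherwise $b_i$ is uniform on $(b_{i1},1]$; * after any $b_{i1}\in[0,1)$ and being ranked second, $b_i$ is uniform on $(b_{i1},1]$; * at the exempted information set, $\beta_{i2}$ is optimal up to $\varepsilon$. -/

import Mathlib

open MeasureTheory ProbabilityTheory Filter Topology
open scoped NNReal ENNReal

namespace RankAuction

/-!
The two-stage all-pay auction (prize worth 1, two players) with rank feedback.

Stage 1: the players simultaneously bid in `[0,1]`; then each is told only whether he is ranked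
first (`true`: the opponent's stage-1 bid lies in `[0,b]`) or second (`false`: it lies in `[b,1]`),
where `b` is his own stage-1 bid; ties are broken by a fair coin.
Stage 2: the players simultaneously place further bids in `[0,∞)`.
The higher total bid wins the prize, ties being broken by a fair coin; all bids are paid.
-/

/-- Stage-1 bids. -/
abbrev Bid1 : Type := unitInterval

/-- Stage-2 bids. -/
abbrev Bid2 : Type := ℝ≥0

/-- The feedback received: `true` if ranked first in stage 1, `false` if ranked second. -/
abbrev Rank : Type := Bool

/-- The other player. -/
def opponent (i : Fin 2) : Fin 2 := i.rev

/-- The probability that a player with stage-1 bid `x` whose opponent bids `y` is given rank `r`. -/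
noncomputable def rankProb (x y : Bid1) (r : Rank) : ℝ≥0∞ :=
  if x = y then 2⁻¹ else if decide (y < x) = r then 1 else 0

/-- The total bid. -/
def total (x : Bid1) (c : Bid2) : ℝ := (x : ℝ) + (c : ℝ)

/-- The probability that total bid `s` wins the prize against total bid `t`. -/
noncomputable def winProb (s t : ℝ) : ℝ≥0∞ :=
  if t < s then 1 else if s = t then 2⁻¹ else 0

/-- A behavioural strategy: a distribution of the stage-1 bid and, for each information set
(own stage-1 bid, own rank), a distribution of the stage-2 bid, depending measurably on it. -/
structure Strategy where
  first : ProbabilityMeasure Bid1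
  second : Kernel (Bid1 × Rank) Bid2
  isMarkov : IsMarkovKernel second

/-- The distribution of the stage-2 bid at the information set `(b, r)`. -/
noncomputable def Strategy.secondLaw (σ : Strategy) (b : Bid1) (r : Rank) :
    ProbabilityMeasure Bid2 :=
  ⟨σ.second (b, r), σ.isMarkov.isProbabilityMeasure (b, r)⟩

/-- The distribution of the total bid of a player who is at the information set `(b, r)`. -/
noncomputable def Strategy.totalLaw (σ : Strategy) (b : Bid1) (r : Rank) : Measure ℝ :=
  (σ.second (b, r)).map (total b)

/-- A strategy is pure if the stage-1 bid is deterministic (stage-2 bids may be random). -/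
def Strategy.IsPure (σ : Strategy) : Prop :=
  ∃ a : Bid1, (σ.first : Measure Bid1) = Measure.dirac a

/-- The beliefs of a player: for each information set, a distribution of the opponent's
stage-1 bid. -/
abbrev Belief : Type := Bid1 → Rank → ProbabilityMeasure Bid1

/-- Ex ante expectation, when a player uses `σ` and his opponent `τ`, of a function
`f x c y d` of his bids `x`, `c` in the two stages and of the opponent's bids `y`, `d`. -/
noncomputable def expect (σ τ : Strategy) (f : Bid1 → Bid2 → Bid1 → Bid2 → ℝ≥0∞) : ℝ≥0∞ :=
  ∫⁻ x, ∫⁻ y, ∑ r : Rank, rankProb x y r *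
      (∫⁻ c, ∫⁻ d, f x c y d ∂(τ.second (y, !r)) ∂(σ.second (x, r)))
    ∂(τ.first : Measure Bid1) ∂(σ.first : Measure Bid1)

/-- Ex ante expected utility of `σ` against `τ`: probability of winning minus expected total bid.
It lies in `[-∞, 1]`, the subtrahend being possibly infinite. -/
noncomputable def utility (σ τ : Strategy) : EReal :=
  (expect σ τ (fun x c y d => winProb (total x c) (total y d)) : EReal) -
    (expect σ τ (fun x c _ _ => ENNReal.ofReal (total x c)) : EReal)

/-- Ex ante probability that the total bid of a player using `σ` against `τ` lies in `s`. -/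
noncomputable def totalBidProb (σ τ : Strategy) (s : Set ℝ) : ℝ≥0∞ :=
  expect σ τ (fun x c _ _ => s.indicator 1 (total x c))

/-- Expected continuation utility (the stage-1 bid is sunk) of bidding according to `ρ` in stage 2
at the information set `(b, r)`, under the belief `ν` about the opponent's stage-1 bid, when the
opponent uses `τ`. -/
noncomputable def continuationUtility (τ : Strategy) (ν : ProbabilityMeasure Bid1)
    (b : Bid1) (r : Rank) (ρ : ProbabilityMeasure Bid2) : EReal :=
  ((∫⁻ y, ∫⁻ c, ∫⁻ d, winProb (total b c) (total y d)
      ∂(τ.second (y, !r)) ∂(ρ : Measure Bid2) ∂(ν : Measure Bid1) : ℝ≥0∞) : EReal) -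
    ((∫⁻ c, (c : ℝ≥0∞) ∂(ρ : Measure Bid2) : ℝ≥0∞) : EReal)

/-- The probability that a player who bids `b` against `τ` in stage 1 is given rank `r`. -/
noncomputable def signalProb (τ : Strategy) (b : Bid1) (r : Rank) : ℝ≥0∞ :=
  ∫⁻ y, rankProb b y r ∂(τ.first : Measure Bid1)

/-- The beliefs `m` against `τ` obey Bayes' rule wherever it applies, that is, at every
information set `(b, r)` with `signalProb τ b r ≠ 0`. -/
def IsBayesian (τ : Strategy) (m : Belief) : Prop :=
  ∀ b r, signalProb τ b r ≠ 0 → ∀ s : Set Bid1, MeasurableSet s →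
    (m b r : Measure Bid1) s =
      (∫⁻ y in s, rankProb b y r ∂(τ.first : Measure Bid1)) / signalProb τ b r

/-- Completely mixed: full support in both stages, and the rank signals have positive probability
at every stage-1 bid of the opponent, so that Bayes' rule determines all of his beliefs. -/
structure Strategy.IsCompletelyMixed (σ : Strategy) : Prop where
  first_pos : ∀ U : Set Bid1, IsOpen U → U.Nonempty → (σ.first : Measure Bid1) U ≠ 0
  second_pos : ∀ b r, ∀ U : Set Bid2, IsOpen U → U.Nonempty → σ.second (b, r) U ≠ 0
  signal_pos : ∀ b r, signalProb σ b r ≠ 0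

/-- Consistency: the assessment is the limit (weakly, at every information set) of completely
mixed strategies together with the beliefs that they induce by Bayes' rule. -/
def IsConsistent (β : Fin 2 → Strategy) (μ : Fin 2 → Belief) : Prop :=
  ∃ (βs : ℕ → Fin 2 → Strategy) (μs : ℕ → Fin 2 → Belief),
    (∀ n i, (βs n i).IsCompletelyMixed) ∧
    (∀ n i, IsBayesian (βs n (opponent i)) (μs n i)) ∧
    (∀ i, Tendsto (fun n => (βs n i).first) atTop (𝓝 (β i).first)) ∧
    (∀ i b r, Tendsto (fun n => (βs n i).secondLaw b r) atTop (𝓝 ((β i).secondLaw b r))) ∧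
    (∀ i b r, Tendsto (fun n => μs n i b r) atTop (𝓝 (μ i b r)))

/-- `(β, μ)` is sequentially rational for player `i` at his information set `(b, r)`, up to `ε`. -/
def IsRationalAt (β : Fin 2 → Strategy) (μ : Fin 2 → Belief) (ε : ℝ) (i : Fin 2)
    (b : Bid1) (r : Rank) : Prop :=
  ∀ ρ : ProbabilityMeasure Bid2,
    continuationUtility (β (opponent i)) (μ i b r) b r ρ ≤
      continuationUtility (β (opponent i)) (μ i b r) b r ((β i).secondLaw b r) + (ε : EReal)

/-- Sequential equilibrium under rank feedback. Rationality is imposed on the whole strategy at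
the initial node and on its continuation at every stage-2 information set, except the
set `(1, false)` of a player who made the maximal stage-1 bid and was still ranked second: he knows
that the total bid of the opponent is at least 1, and where it equals 1 he has no best response
at all (any total bid above 1 wins, and the cheaper the better). -/
structure IsSequentialEquilibrium (β : Fin 2 → Strategy) (μ : Fin 2 → Belief) : Prop where
  rational_initial : ∀ i, ∀ σ : Strategy,
    utility σ (β (opponent i)) ≤ utility (β i) (β (opponent i))
  rational_second : ∀ i b r, ¬ (b = 1 ∧ r = false) → IsRationalAt β μ 0 i b r
  bayesian : ∀ i, IsBayesian (β (opponent i)) (μ i)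
  consistent : IsConsistent β μ

/-- The uniform distribution on `(a, b]` (used for `a < b`). -/
noncomputable def uniform (a b : ℝ) : Measure ℝ := (volume : Measure ℝ)[|Set.Ioc a b]

/-- Cheapest signal belief, adapted to rank feedback: the opponent's stage-1 bid is believed to be
the lowest one compatible with the signal `[0,b]`, respectively `[b,1]`. -/
def IsCheapestSignalBelief (m : Belief) : Prop :=
  ∀ b : Bid1, (m b true : Measure Bid1) = Measure.dirac 0 ∧
    (m b false : Measure Bid1) = Measure.dirac b

/-- Cheapest signal strategy, adapted to rank feedback. -/
structure IsCheapestSignalStrategy (σ : Strategy) : Prop where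
  first_eq : (σ.first : Measure Bid1) = Measure.dirac 0
  total_first : ∀ b : Bid1, σ.totalLaw b true =
    ENNReal.ofReal b • Measure.dirac (b : ℝ) + ENNReal.ofReal (1 - b) • uniform b 1
  total_second : ∀ b : Bid1, b < 1 → σ.totalLaw b false = uniform b 1

end RankAuction

/-! Uniqueness uses only ex ante optimality. Let the stage-1 bids be `x ≥ y`. Each pair of matching
information sets reached on path is an all-pay auction with complete information in total bids
bounded below by `x` and `y`. Since no bid improves on the equilibrium payoff
(`IsBestResponse.second_stage`), the distribution function of either total bid is at most the other
player's payoff plus the bid. The two payoffs add up to one minus the expected total bids, and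
expected bids are bounded below by integrals of tails (`integral_one_sub_cdf_le`). Summing these
estimates leaves no slack, so all of them are equalities (`headStart_tight`) and both distribution
functions have slope one on `[x, y+1)`.

If `x = y`, the intercepts force every payoff to be `-x`. Bidding zero throughout guarantees a
nonnegative payoff, so `x = 0` and the total bids are uniform (`IsBestResponse.eq_zero_of_tie`). If
`y < x`, the trailing player earns `-y`, hence `y = 0`; the leader earns zero, and the trailing
player's total bid is zero with probability `x`. The leader then gains by bidding zero in stage 1:
with probability one half he is ranked first and faces that same law, against which a bid of `x/2`
wins with probability at least `x` (`IsBestResponse.not_lt`).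

For existence, the believed law of the opponent's total bid has distribution function `s` at every
feasible `s ≤ 1`, except that the player at the exempted set has only `s = 1` left there. So a total
bid `s` wins with probability at most `s`, with equality almost surely under the prescribed bids
outside that set (`continuationUtility_le`, `isBestResponse_cheapestStrategy`). Consistency comes
from stage-1 trembles with weights `exp(-n y)`: conditioned on a signal, they concentrate on the
lowest compatible bid (`tendsto_dirac_of_tiltMass`). -/

namespace RankAuction

/-! ### All-pay auctions with a head start: tightness of the equilibrium inequalities -/

/-- Layer cake: the mean excess over a lower bound `b` is at least the integral of the tail over an
interval of length one. -/
lemma integral_one_sub_cdf_le (Q : Measure ℝ) [IsProbabilityMeasure Q] {b : ℝ}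
    (hb : ∀ᵐ t ∂Q, b ≤ t) (hQ : Integrable (fun t => t) Q) :
    ∫ s in b..b + 1, (1 - cdf Q s) ≤ ∫ t, t ∂Q - b := by
  -- Truncating the excess at one lowers its mean and makes the tail vanish beyond one, so the
  -- layer-cake integral reduces to the unit interval.
  have hint : Integrable (fun t : ℝ => min (t - b) 1) Q :=
    (hQ.sub (integrable_const b)).inf (integrable_const 1)
  have hnn : 0 ≤ᵐ[Q] fun t : ℝ => min (t - b) 1 := by
    filter_upwards [hb] with t ht
    exact le_min (sub_nonneg.2 ht) zero_le_one
  have h1 : ∫ t, min (t - b) 1 ∂Q ≤ ∫ t, t ∂Q - b := by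
    calc ∫ t, min (t - b) 1 ∂Q ≤ ∫ t, (t - b) ∂Q :=
          integral_mono hint (hQ.sub (integrable_const b)) fun t => min_le_left _ _
      _ = ∫ t, t ∂Q - b := by
          rw [integral_sub hQ (integrable_const b)]; simp
  refine le_trans (le_of_eq ?_) h1
  rw [hint.integral_eq_integral_meas_lt hnn,
    setIntegral_eq_of_subset_of_forall_sdiff_eq_zero measurableSet_Ioi
      (Set.Ioo_subset_Ioi_self : Set.Ioo (0 : ℝ) 1 ⊆ Set.Ioi 0)]
  · have hshift : ∫ s in b..b + 1, (1 - cdf Q s) = ∫ u in (0 : ℝ)..1, (1 - cdf Q (u + b)) := by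
      rw [intervalIntegral.integral_comp_add_right (fun s => 1 - cdf Q s), zero_add, add_comm 1 b]
    rw [hshift, intervalIntegral.integral_of_le zero_le_one, integral_Ioc_eq_integral_Ioo]
    refine setIntegral_congr_fun measurableSet_Ioo fun u hu => ?_
    have : {a : ℝ | u < min (a - b) 1} = (Set.Iic (u + b))ᶜ := by
      ext a
      simp only [Set.mem_ofPred_eq, Set.mem_compl_iff, Set.mem_Iic, lt_min_iff, not_le]
      constructor
      · intro h; linarith [h.1]
      · intro h; exact ⟨by linarith, hu.2⟩
    rw [this, probReal_compl_eq_one_sub measurableSet_Iic, cdf_eq_real]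
  · intro u hu
    have h1u : 1 ≤ u := by
      by_contra h
      exact hu.2 ⟨hu.1, not_le.1 h⟩
    have : {a : ℝ | u < min (a - b) 1} = ∅ := by
      ext a
      simp only [Set.mem_ofPred_eq, lt_min_iff, Set.mem_empty_iff_false, iff_false]
      intro h; linarith [h.2]
    rw [this]; simp

/-- A right-continuous monotone function below a continuous one with no smaller integral agrees
with it. -/
lemma stieltjes_eq_of_integral_le (F : StieltjesFunction ℝ) {g : ℝ → ℝ} (hg : Continuous g)
    {u w : ℝ} (huw : u ≤ w) (hle : ∀ s ∈ Set.Icc u w, F s ≤ g s)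
    (hint : ∫ s in u..w, g s ≤ ∫ s in u..w, F s) :
    ∀ s ∈ Set.Ico u w, F s = g s := by
  have hF : IntervalIntegrable F volume u w := F.mono.intervalIntegrable
  have hgi : IntervalIntegrable g volume u w := hg.intervalIntegrable u w
  have hnn : 0 ≤ᵐ[volume.restrict (Set.Ioc u w)] fun s => g s - F s := by
    filter_upwards [ae_restrict_mem measurableSet_Ioc] with s hs
    exact sub_nonneg.2 (hle s (Set.Ioc_subset_Icc_self hs))
  have h0 : ∫ s in u..w, (g s - F s) = 0 := by
    apply le_antisymm
    · rw [intervalIntegral.integral_sub hgi hF]; linarith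
    · rw [intervalIntegral.integral_of_le huw]
      exact integral_nonneg_of_ae hnn
  have hae := (intervalIntegral.integral_eq_zero_iff_of_le_of_nonneg_ae huw hnn (hgi.sub hF)).1 h0
  -- The functions agree almost everywhere. By right continuity a discrepancy at `s` would persist
  -- on an interval to the right of `s`, which has positive measure; this is why the right endpoint
  -- is excluded.
  intro s hs
  by_contra hne
  have hF' : Tendsto F (𝓝[>] s) (𝓝 (F s)) :=
    (F.right_continuous s).mono_left (nhdsWithin_mono _ Set.Ioi_subset_Ici_self)
  have hg' : Tendsto g (𝓝[>] s) (𝓝 (g s)) := (hg.tendsto s).mono_left nhdsWithin_le_nhds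
  have hev : ∀ᶠ x in 𝓝[>] s, F x ≠ g x :=
    ((hF'.sub hg').eventually_ne (sub_ne_zero.2 hne)).mono fun x => sub_ne_zero.1
  obtain ⟨v, hv, hsub⟩ := (mem_nhdsGT_iff_exists_Ioo_subset' hs.2).1 hev
  have hv' : s < min v w := lt_min hv hs.2
  have hpos : (volume.restrict (Set.Ioc u w)) (Set.Ioo s (min v w)) ≠ 0 := by
    rw [Measure.restrict_apply measurableSet_Ioo, Set.inter_eq_left.2]
    · rw [Real.volume_Ioo]
      simpa using hv'
    · intro x hx
      exact ⟨hs.1.trans_lt hx.1, (hx.2.trans_le (min_le_right _ _)).le⟩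
  apply hpos
  refine measure_mono_null (fun x hx => ?_) hae
  have := hsub ⟨hx.1, hx.2.trans_le (min_le_left _ _)⟩
  simp only [Set.mem_compl_iff, Set.mem_ofPred_eq, Pi.zero_apply]
  exact fun h => this (sub_eq_zero.1 h).symm

/-- The equilibrium inequalities of the all-pay auction with head start `a - b ∈ [0,1]` are all
tight. -/
lemma headStart_tight (P Q : Measure ℝ) [IsProbabilityMeasure P] [IsProbabilityMeasure Q]
    {a b v₁ v₂ : ℝ} (hba : b ≤ a) (hab : a ≤ b + 1)
    (hP : ∀ᵐ s ∂P, a ≤ s) (hQ : ∀ᵐ t ∂Q, b ≤ t)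
    (hPi : Integrable (fun s => s) P) (hQi : Integrable (fun t => t) Q)
    (hv : v₁ + v₂ = 1 - ∫ s, s ∂P - ∫ t, t ∂Q)
    (h₁ : ∀ s, a ≤ s → cdf Q s ≤ v₁ + s) (h₂ : ∀ t, b ≤ t → cdf P t ≤ v₂ + t) :
    (a - b) * (v₂ + b) = 0 ∧ (a - b) * (v₁ + a - cdf Q a) = 0 ∧
      (∀ s ∈ Set.Ico a (b + 1), cdf Q s = v₁ + s) ∧
      (∀ s ∈ Set.Ico a (b + 1), cdf P s = v₂ + s) ∧
      (∀ s ∈ Set.Ico b a, cdf Q s = cdf Q a) := by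
  have iQ : ∀ u w : ℝ, IntervalIntegrable (cdf Q) volume u w :=
    fun u w => (cdf Q).mono.intervalIntegrable
  have iP : ∀ u w : ℝ, IntervalIntegrable (cdf P) volume u w :=
    fun u w => (cdf P).mono.intervalIntegrable
  have ic : ∀ (c u w : ℝ), IntervalIntegrable (fun s => c + s) volume u w :=
    fun c u w => Continuous.intervalIntegrable (by fun_prop) u w
  have lin : ∀ c : ℝ, ∫ s in a..b + 1, (c + s) =
      (b + 1 - a) * c + ((b + 1) ^ 2 - a ^ 2) / 2 := by
    intro c
    rw [intervalIntegral.integral_add (by simp) (by simp), integral_id]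
    simp
  have hA := integral_one_sub_cdf_le P hP hPi
  have hB := integral_one_sub_cdf_le Q hQ hQi
  -- Both tail integrals are split so as to isolate the common interval `[a, b + 1]`. What remains
  -- is `[b + 1, a + 1]` for `P`, where the distribution function is at most one, and `[b, a]` for
  -- `Q`, where it is at most its value at `a`.
  rw [intervalIntegral.integral_sub (by simp) (iP _ _),
    ← intervalIntegral.integral_add_adjacent_intervals (iP a (b + 1)) (iP (b + 1) (a + 1))] at hA
  rw [intervalIntegral.integral_sub (by simp) (iQ _ _),
    ← intervalIntegral.integral_add_adjacent_intervals (iQ b a) (iQ a (b + 1))] at hB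
  have htop : ∫ s in b + 1..a + 1, cdf P s ≤ a - b := by
    calc ∫ s in b + 1..a + 1, cdf P s ≤ ∫ s in b + 1..a + 1, (1 : ℝ) :=
          intervalIntegral.integral_mono_on (by linarith) (iP _ _) (by simp)
            fun s _ => cdf_le_one P s
      _ = a - b := by simp
  have hlow : ∫ s in b..a, cdf Q s ≤ ∫ s in b..a, cdf Q a :=
    intervalIntegral.integral_mono_on hba (iQ _ _) (by simp) fun s hs => (cdf Q).mono hs.2
  have hmQ : ∫ s in a..b + 1, cdf Q s ≤ ∫ s in a..b + 1, (v₁ + s) :=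
    intervalIntegral.integral_mono_on hab (iQ _ _) (ic _ _ _) fun s hs => h₁ s hs.1
  have hmP : ∫ s in a..b + 1, cdf P s ≤ ∫ s in a..b + 1, (v₂ + s) :=
    intervalIntegral.integral_mono_on hab (iP _ _) (ic _ _ _) fun s hs => h₂ s (hba.trans hs.1)
  have hk : 0 ≤ (a - b) * (v₁ + a - cdf Q a) :=
    mul_nonneg (by linarith) (by linarith [h₁ a le_rfl])
  have hl : 0 ≤ (a - b) * (v₂ + b) :=
    mul_nonneg (by linarith) (by linarith [h₂ b le_rfl, cdf_nonneg P b])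
  have l1 := lin v₁
  have l2 := lin v₂
  have hc : ∫ s in b..a, cdf Q a = (a - b) * cdf Q a := by simp
  simp only [intervalIntegral.integral_const, smul_eq_mul, mul_one] at hA hB
  -- Adding `hA` and `hB` and inserting `hv` and the four bounds gives `(a - b)(v₂ + b) + (a - b)(v₁
  -- + a - cdf Q a) ≤ 0`. Both summands are nonnegative by `hl` and `hk`, so they vanish and each
  -- bound used is an equality.
  refine ⟨?_, ?_, ?_, ?_, ?_⟩
  · nlinarith
  · nlinarith
  · exact stieltjes_eq_of_integral_le _ (by fun_prop) hab (fun s hs => h₁ s hs.1) (by nlinarith)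
  · exact stieltjes_eq_of_integral_le _ (by fun_prop) hab
      (fun s hs => h₂ s (hba.trans hs.1)) (by nlinarith)
  · exact stieltjes_eq_of_integral_le _ (g := fun _ => cdf Q a) (by fun_prop) hba
      (fun s hs => (cdf Q).mono hs.2) (by nlinarith)

/-- A probability measure with the distribution function of the uniform law on `(0,1]`. -/
lemma eq_uniform_of_cdf (Q : Measure ℝ) [IsProbabilityMeasure Q] (h0 : ∀ᵐ t ∂Q, 0 ≤ t)
    (h : ∀ s ∈ Set.Ico (0 : ℝ) 1, cdf Q s = s) : Q = uniform 0 1 := by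
  have hU : uniform 0 1 = volume.restrict (Set.Ioc (0 : ℝ) 1) := by
    simp [uniform, ProbabilityTheory.cond]
  rw [hU]
  refine Measure.ext_of_Iic _ _ fun s => ?_
  rw [Measure.restrict_apply measurableSet_Iic, Set.inter_comm, Set.Ioc_inter_Iic, Real.volume_Ioc,
    sub_zero, ← ofReal_measureReal, ← cdf_eq_real]
  rcases lt_or_ge s 0 with hs | hs
  · have : Q.real (Set.Iic s) = 0 := by
      rw [measureReal_eq_zero_iff]
      refine measure_mono_null (fun t ht => ?_) h0
      exact not_le.2 (lt_of_le_of_lt ht hs)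
    rw [cdf_eq_real, this, ENNReal.ofReal_of_nonpos ((min_le_right _ _).trans hs.le)]
    simp
  · rcases lt_or_ge s 1 with hs1 | hs1
    · rw [h s ⟨hs, hs1⟩, min_eq_right hs1.le]
    · rw [min_eq_left hs1]
      congr 1
      -- Values of `cdf Q` just below one are arbitrarily close to one, and monotonicity carries
      -- this to all `s ≥ 1`.
      refine le_antisymm (cdf_le_one Q s) (le_of_forall_lt fun x hx => ?_)
      have hm : max x 0 < 1 := max_lt hx one_pos
      obtain ⟨y, hy, hy1⟩ := exists_between hm
      calc x < y := (le_max_left _ _).trans_lt hy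
        _ = cdf Q y := (h y ⟨(le_max_right _ _).trans hy.le, hy1⟩).symm
        _ ≤ cdf Q s := (cdf Q).mono (hy1.le.trans hs1)

/-! ### Winning probabilities, rank probabilities and laws of total bids -/

lemma measurable_winProb : Measurable fun p : ℝ × ℝ => winProb p.1 p.2 := by
  unfold winProb
  refine Measurable.ite (measurableSet_lt measurable_snd measurable_fst) measurable_const ?_
  exact Measurable.ite (measurableSet_eq_fun measurable_fst measurable_snd) measurable_const
    measurable_const

lemma measurable_winProb_left (s : ℝ) : Measurable (winProb s) :=
  measurable_winProb.comp measurable_prodMk_left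

@[fun_prop]
lemma measurable_total (b : Bid1) : Measurable (total b) := by
  unfold total; fun_prop

lemma measurable_rankProb (b : Bid1) (r : Rank) : Measurable fun y => rankProb b y r := by
  unfold rankProb
  refine Measurable.ite (measurableSet_eq_fun measurable_const measurable_id) measurable_const ?_
  refine Measurable.ite ?_ measurable_const measurable_const
  cases r
  · convert (measurableSet_Ici : MeasurableSet (Set.Ici b)) using 1
    ext y; simp
  · convert (measurableSet_Iio : MeasurableSet (Set.Iio b)) using 1
    ext y; simp

lemma winProb_add_swap (s t : ℝ) : winProb s t + winProb t s = 1 := by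
  unfold winProb
  rcases lt_trichotomy s t with h | h | h
  · simp [h, h.not_gt, h.ne]
  · simp [h, ENNReal.inv_two_add_inv_two]
  · simp [h, h.not_gt, (show t ≠ s from h.ne)]

/-- Together with the next bound this confines the effect of the tie-breaking rule to atoms: a
winning probability lies between the open and the closed distribution function. -/
lemma winProb_le_indicator (s t : ℝ) : winProb s t ≤ (Set.Iic s).indicator 1 t := by
  unfold winProb
  split_ifs with h1 h2
  · simp [h1.le]
  · simp [h2]
  · simp

lemma indicator_le_winProb (s t : ℝ) : (Set.Iio s).indicator 1 t ≤ winProb s t := by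
  unfold winProb
  split_ifs with h1 h2
  · simp [h1]
  · simp [h2]
  · simp [h1]

lemma lintegral_winProb_le (s : ℝ) (Q : Measure ℝ) : ∫⁻ t, winProb s t ∂Q ≤ Q (Set.Iic s) :=
  (lintegral_mono (winProb_le_indicator s)).trans (lintegral_indicator_one measurableSet_Iic).le

lemma le_lintegral_winProb (s : ℝ) (Q : Measure ℝ) : Q (Set.Iio s) ≤ ∫⁻ t, winProb s t ∂Q :=
  (lintegral_indicator_one measurableSet_Iio).symm.le.trans
    (lintegral_mono (indicator_le_winProb s))

/-- The probability that a total bid with law `P` wins against an independent one with law `Q`. -/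
noncomputable def prizeProb (P Q : Measure ℝ) : ℝ≥0∞ := ∫⁻ s, ∫⁻ t, winProb s t ∂Q ∂P

/-- The prize is always awarded to exactly one player; Tonelli exchanges the roles of the two bids.
-/
lemma prizeProb_add_swap (P Q : Measure ℝ) [IsProbabilityMeasure P] [IsProbabilityMeasure Q] :
    prizeProb P Q + prizeProb Q P = 1 := by
  have h : prizeProb Q P = ∫⁻ s, ∫⁻ t, winProb t s ∂Q ∂P := by
    unfold prizeProb
    exact lintegral_lintegral_swap measurable_winProb.aemeasurable
  rw [h, prizeProb, ← lintegral_add_left measurable_winProb.lintegral_prod_right']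
  have : ∀ s, ∫⁻ t, winProb s t ∂Q + ∫⁻ t, winProb t s ∂Q = 1 := by
    intro s
    rw [← lintegral_add_left (measurable_winProb_left s)]
    simp [winProb_add_swap]
  simp [this]

lemma prizeProb_le_one (P Q : Measure ℝ) [IsProbabilityMeasure P] [IsProbabilityMeasure Q] :
    prizeProb P Q ≤ 1 :=
  le_self_add.trans (prizeProb_add_swap P Q).le

lemma prizeProb_ne_top (P Q : Measure ℝ) [IsProbabilityMeasure P] [IsProbabilityMeasure Q] :
    prizeProb P Q ≠ ⊤ :=
  ((prizeProb_le_one P Q).trans_lt ENNReal.one_lt_top).ne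

lemma prizeProb_dirac (s : ℝ) (Q : Measure ℝ) :
    prizeProb (Measure.dirac s) Q = ∫⁻ t, winProb s t ∂Q := by
  rw [prizeProb, lintegral_dirac]

instance (σ : Strategy) : IsMarkovKernel σ.second := σ.isMarkov

instance (σ : Strategy) (b : Bid1) (r : Rank) : IsProbabilityMeasure (σ.totalLaw b r) :=
  Measure.isProbabilityMeasure_map (measurable_total b).aemeasurable

lemma le_totalLaw (σ : Strategy) (b : Bid1) (r : Rank) : ∀ᵐ s ∂σ.totalLaw b r, (b : ℝ) ≤ s := by
  rw [Strategy.totalLaw, ae_map_iff (measurable_total b).aemeasurable measurableSet_Ici]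
  exact Eventually.of_forall fun c => by simp [total]

lemma totalLaw_nonneg (σ : Strategy) (b : Bid1) (r : Rank) : ∀ᵐ s ∂σ.totalLaw b r, 0 ≤ s :=
  (le_totalLaw σ b r).mono fun _ hs => b.2.1.trans hs

lemma rankProb_le_one (x y : Bid1) (r : Rank) : rankProb x y r ≤ 1 := by
  unfold rankProb
  split_ifs <;> simp

lemma rankProb_ne_top (x y : Bid1) (r : Rank) : rankProb x y r ≠ ⊤ :=
  ((rankProb_le_one x y r).trans_lt ENNReal.one_lt_top).ne

lemma rankProb_self (x : Bid1) (r : Rank) : rankProb x x r = 2⁻¹ := by simp [rankProb]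

/-- Lets one node be read from either player's side; the fair coin keeps this valid at ties. -/
lemma rankProb_swap (x y : Bid1) (r : Rank) : rankProb y x (!r) = rankProb x y r := by
  unfold rankProb
  rcases lt_trichotomy x y with h | h | h
  · cases r <;> simp [h, h.ne, h.ne', h.not_gt]
  · simp [h]
  · cases r <;> simp [h, h.ne, h.ne', h.not_gt]

/-! ### Payoffs and deviations when stage-1 bids are deterministic -/

section pure

variable {σ τ : Strategy} {x y : Bid1}

/-- The winning probability against an opponent at a given information set. -/
lemma lintegral_winProb_total (τ : Strategy) (s : ℝ) (y : Bid1) (r : Rank) :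
    ∫⁻ d, winProb s (total y d) ∂τ.second (y, r) = ∫⁻ t, winProb s t ∂τ.totalLaw y r := by
  rw [Strategy.totalLaw, lintegral_map (measurable_winProb_left s) (measurable_total y)]

lemma expect_pure (hσ : (σ.first : Measure Bid1) = Measure.dirac x)
    (hτ : (τ.first : Measure Bid1) = Measure.dirac y) (f : Bid1 → Bid2 → Bid1 → Bid2 → ℝ≥0∞) :
    expect σ τ f = ∑ r : Rank, rankProb x y r *
      ∫⁻ c, ∫⁻ d, f x c y d ∂τ.second (y, !r) ∂σ.second (x, r) := by
  rw [expect, hσ, hτ, lintegral_dirac, lintegral_dirac]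

lemma expect_win_pure (hσ : (σ.first : Measure Bid1) = Measure.dirac x)
    (hτ : (τ.first : Measure Bid1) = Measure.dirac y) :
    expect σ τ (fun x c y d => winProb (total x c) (total y d)) =
      ∑ r : Rank, rankProb x y r * prizeProb (σ.totalLaw x r) (τ.totalLaw y (!r)) := by
  rw [expect_pure hσ hτ]
  refine Finset.sum_congr rfl fun r _ => ?_
  simp_rw [lintegral_winProb_total]
  rw [prizeProb]
  conv_rhs => rw [Strategy.totalLaw]
  rw [lintegral_map measurable_winProb.lintegral_prod_right' (measurable_total x)]

lemma expect_own_pure (hσ : (σ.first : Measure Bid1) = Measure.dirac x)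
    (hτ : (τ.first : Measure Bid1) = Measure.dirac y) {g : ℝ → ℝ≥0∞} (hg : Measurable g) :
    expect σ τ (fun x c _ _ => g (total x c)) =
      ∑ r : Rank, rankProb x y r * ∫⁻ s, g s ∂σ.totalLaw x r := by
  rw [expect_pure hσ hτ]
  refine Finset.sum_congr rfl fun r _ => ?_
  rw [Strategy.totalLaw, lintegral_map hg (measurable_total x)]
  simp

/-- The strategy of bidding `x` and then according to `κ r` after being given rank `r`. -/
noncomputable def pureStrategy (x : Bid1) (κ : Rank → Measure Bid2)
    (hκ : ∀ r, IsProbabilityMeasure (κ r)) : Strategy where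
  first := ⟨Measure.dirac x, inferInstance⟩
  second := (Kernel.ofFunOfCountable κ).comap Prod.snd measurable_snd
  isMarkov := ⟨fun p => hκ p.2⟩

lemma pureStrategy_first (x : Bid1) (κ : Rank → Measure Bid2)
    (hκ : ∀ r, IsProbabilityMeasure (κ r)) :
    ((pureStrategy x κ hκ).first : Measure Bid1) = Measure.dirac x := rfl

/-- Turns utility comparisons in `EReal` into subtraction-free ones. The cost `d` may be infinite a
priori: a finite left side excludes it, which is how best responses are seen to have finite expected
cost. -/
lemma coe_sub_le_coe_sub_iff {a b c d : ℝ≥0∞} (hb : b ≠ ⊤) (ha : a ≠ ⊤) (hc : c ≠ ⊤) :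
    (a : EReal) - (b : EReal) ≤ (c : EReal) - (d : EReal) ↔ d ≠ ⊤ ∧ a + d ≤ c + b := by
  lift a to ℝ≥0 using ha
  lift b to ℝ≥0 using hb
  lift c to ℝ≥0 using hc
  have hsub : ∀ p q : ℝ≥0, ((p : ℝ≥0∞) : EReal) - ((q : ℝ≥0∞) : EReal) =
      ((p - q : ℝ) : EReal) := fun p q => rfl
  rw [hsub]
  induction d with
  | top =>
    have : ((c : ℝ≥0∞) : EReal) - ((⊤ : ℝ≥0∞) : EReal) = ⊥ := rfl
    rw [this, le_bot_iff]
    simp only [EReal.coe_ne_bot, ne_eq, not_true_eq_false, false_and]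
  | coe d =>
    rw [hsub, EReal.coe_le_coe_iff, ← ENNReal.coe_add, ← ENNReal.coe_add, ENNReal.coe_le_coe,
      ← NNReal.coe_le_coe]
    push_cast
    constructor
    · intro h; exact ⟨ENNReal.coe_ne_top, by linarith⟩
    · rintro ⟨-, h⟩; linarith

/-- `σ` maximizes the ex ante expected utility against `τ`. -/
def IsBestResponse (σ τ : Strategy) : Prop := ∀ σ' : Strategy, utility σ' τ ≤ utility σ τ

lemma expect_win_pure_ne_top (hσ : (σ.first : Measure Bid1) = Measure.dirac x)
    (hτ : (τ.first : Measure Bid1) = Measure.dirac y) :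
    expect σ τ (fun x c y d => winProb (total x c) (total y d)) ≠ ⊤ := by
  rw [expect_win_pure hσ hτ]
  exact ENNReal.sum_ne_top.2 fun r _ =>
    ENNReal.mul_ne_top (rankProb_ne_top _ _ _) (prizeProb_ne_top _ _)

/-- A pure deviation of finite expected cost does not pay. -/
lemma IsBestResponse.pure_deviation (h : IsBestResponse σ τ)
    (hσ : (σ.first : Measure Bid1) = Measure.dirac x)
    (hτ : (τ.first : Measure Bid1) = Measure.dirac y) (z : Bid1) (κ : Rank → Measure Bid2)
    (hκ : ∀ r, IsProbabilityMeasure (κ r))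
    (hfin : ∀ r, rankProb z y r * ∫⁻ s, ENNReal.ofReal s ∂(κ r).map (total z) ≠ ⊤) :
    expect σ τ (fun x c _ _ => ENNReal.ofReal (total x c)) ≠ ⊤ ∧
    (∑ r : Rank, rankProb z y r * prizeProb ((κ r).map (total z)) (τ.totalLaw y (!r))) +
        expect σ τ (fun x c _ _ => ENNReal.ofReal (total x c)) ≤
      expect σ τ (fun x c y d => winProb (total x c) (total y d)) +
        ∑ r : Rank, rankProb z y r * ∫⁻ s, ENNReal.ofReal s ∂(κ r).map (total z) := by
  have hz := pureStrategy_first z κ hκ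
  have := h (pureStrategy z κ hκ)
  rw [utility, utility, coe_sub_le_coe_sub_iff _ (expect_win_pure_ne_top hz hτ)
    (expect_win_pure_ne_top hσ hτ), expect_own_pure hz hτ ENNReal.measurable_ofReal,
    expect_win_pure hz hτ] at this
  · exact this
  · rw [expect_own_pure hz hτ ENNReal.measurable_ofReal]
    exact ENNReal.sum_ne_top.2 fun r _ => hfin r

/-- Bidding zero throughout is a feasible deviation. -/
lemma IsBestResponse.expect_cost_le (h : IsBestResponse σ τ)
    (hσ : (σ.first : Measure Bid1) = Measure.dirac x)
    (hτ : (τ.first : Measure Bid1) = Measure.dirac y) :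
    expect σ τ (fun x c _ _ => ENNReal.ofReal (total x c)) ≠ ⊤ ∧
    expect σ τ (fun x c _ _ => ENNReal.ofReal (total x c)) ≤
      expect σ τ (fun x c y d => winProb (total x c) (total y d)) := by
  have hz : (Measure.dirac (0 : Bid2)).map (total 0) = Measure.dirac 0 := by
    rw [Measure.map_dirac' (measurable_total 0)]; simp [total]
  have := h.pure_deviation hσ hτ 0 (fun _ => Measure.dirac 0) (fun _ => inferInstance)
    (by simp [hz])
  refine ⟨this.1, le_trans le_add_self (this.2.trans ?_)⟩
  simp [hz]

/-- Expected payoff, the bids having laws `P` and `Q`. -/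
noncomputable def payoff (P Q : Measure ℝ) : ℝ := (prizeProb P Q).toReal - ∫ s, s ∂P

/-- Supplies the accounting identity `hv` of `headStart_tight`. -/
lemma payoff_add_swap (P Q : Measure ℝ) [IsProbabilityMeasure P] [IsProbabilityMeasure Q] :
    payoff P Q + payoff Q P = 1 - ∫ s, s ∂P - ∫ t, t ∂Q := by
  have h := congrArg ENNReal.toReal (prizeProb_add_swap P Q)
  rw [ENNReal.toReal_add (prizeProb_ne_top _ _) (prizeProb_ne_top _ _), ENNReal.toReal_one] at h
  unfold payoff
  linarith

lemma integral_eq_toReal_lintegral {P : Measure ℝ} (hP : ∀ᵐ s ∂P, 0 ≤ s) :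
    ∫ s, s ∂P = (∫⁻ s, ENNReal.ofReal s ∂P).toReal :=
  integral_eq_lintegral_of_nonneg_ae hP measurable_id.aestronglyMeasurable

lemma integrable_of_lintegral_ne_top {P : Measure ℝ} (hP : ∀ᵐ s ∂P, 0 ≤ s)
    (h : ∫⁻ s, ENNReal.ofReal s ∂P ≠ ⊤) : Integrable (fun s => s) P :=
  (lintegral_ofReal_ne_top_iff_integrable measurable_id.aestronglyMeasurable hP).1 h

/-- At each information set reached with positive probability, no stage-2 bid does better than the
strategy. -/
lemma IsBestResponse.second_stage (h : IsBestResponse σ τ)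
    (hσ : (σ.first : Measure Bid1) = Measure.dirac x)
    (hτ : (τ.first : Measure Bid1) = Measure.dirac y) {r : Rank} (hr : rankProb x y r ≠ 0) :
    ∫⁻ s, ENNReal.ofReal s ∂σ.totalLaw x r ≠ ⊤ ∧
    ∀ s, (x : ℝ) ≤ s → cdf (τ.totalLaw y (!r)) s ≤
      payoff (σ.totalLaw x r) (τ.totalLaw y (!r)) + s := by
  obtain ⟨hfin, -⟩ := h.expect_cost_le hσ hτ
  rw [expect_own_pure hσ hτ ENNReal.measurable_ofReal, ENNReal.sum_ne_top] at hfin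
  have hC : ∫⁻ s, ENNReal.ofReal s ∂σ.totalLaw x r ≠ ⊤ := fun hC =>
    hfin r (Finset.mem_univ r) (by rw [hC, ENNReal.mul_top hr])
  refine ⟨hC, ?_⟩
  have key : ∀ s, (x : ℝ) ≤ s →
      (τ.totalLaw y (!r)).real (Set.Iio s) ≤ payoff (σ.totalLaw x r) (τ.totalLaw y (!r)) + s := by
    intro s hs
    have hs0 : 0 ≤ s := x.2.1.trans hs
    set c : Bid2 := ⟨s - x, sub_nonneg.2 hs⟩
    have hc : (Measure.dirac c).map (total x) = Measure.dirac s := by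
      rw [Measure.map_dirac' (measurable_total x)]
      congr 1
      exact add_sub_cancel (x : ℝ) s
    -- The deviation changes play only after rank `r`, so the contributions of the other rank are
    -- common to both sides and, being finite, cancel.
    let κ : Rank → Measure Bid2 := fun q => if q = r then Measure.dirac c else σ.second (x, q)
    have hκ : ∀ q, IsProbabilityMeasure (κ q) := by
      intro q
      by_cases hq : q = r
      · simp only [κ, hq, if_true]; infer_instance
      · simp only [κ, hq, if_false]; infer_instance
    have hκr : (κ r).map (total x) = Measure.dirac s := by simp [κ, hc]
    have hκo : (κ (!r)).map (total x) = σ.totalLaw x (!r) := by simp [κ, Strategy.totalLaw]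
    have hsum : ∀ f : Rank → ℝ≥0∞, ∑ q, f q = f r + f (!r) := by
      intro f; cases r <;> simp [add_comm]
    have hdev := (h.pure_deviation hσ hτ x κ hκ ?_).2
    · rw [expect_own_pure hσ hτ ENNReal.measurable_ofReal, expect_win_pure hσ hτ, hsum, hsum, hsum,
        hsum, hκr, hκo, lintegral_dirac, prizeProb_dirac] at hdev
      have hW := ENNReal.mul_ne_top (rankProb_ne_top x y (!r))
        (prizeProb_ne_top (σ.totalLaw x (!r)) (τ.totalLaw y (!!r)))
      have hK := hfin (!r) (Finset.mem_univ _)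
      have hdev' : rankProb x y r * (∫⁻ t, winProb s t ∂τ.totalLaw y (!r) +
          ∫⁻ s, ENNReal.ofReal s ∂σ.totalLaw x r) ≤ rankProb x y r *
          (prizeProb (σ.totalLaw x r) (τ.totalLaw y (!r)) + ENNReal.ofReal s) := by
        rw [← ENNReal.add_le_add_iff_right (ENNReal.add_ne_top.2 ⟨hW, hK⟩)]
        refine le_trans (le_of_eq ?_) (hdev.trans (le_of_eq ?_)) <;> ring
      rw [ENNReal.mul_le_mul_iff_right hr (rankProb_ne_top _ _ _)] at hdev'
      have h2 := (add_le_add_left (le_lintegral_winProb s (τ.totalLaw y (!r))) _).trans hdev'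
      have h3 := ENNReal.toReal_mono (ENNReal.add_ne_top.2 ⟨prizeProb_ne_top _ _,
        ENNReal.ofReal_ne_top⟩) h2
      rw [ENNReal.toReal_add (measure_ne_top _ _) hC, ENNReal.toReal_add (prizeProb_ne_top _ _)
        ENNReal.ofReal_ne_top, ENNReal.toReal_ofReal hs0] at h3
      rw [payoff, integral_eq_toReal_lintegral (totalLaw_nonneg σ x r), measureReal_def]
      linarith
    · intro q
      by_cases hq : q = r
      · subst hq
        rw [hκr, lintegral_dirac]
        exact ENNReal.mul_ne_top (rankProb_ne_top _ _ _) ENNReal.ofReal_ne_top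
      · have : κ q = σ.second (x, q) := by simp [κ, hq]
        rw [this]
        exact hfin q (Finset.mem_univ q)
  intro s hs
  -- A bid of `s` is only sure to beat bids strictly below `s`; overbidding by `ε` also beats an
  -- atom at `s`, and `ε` is arbitrary.
  refine le_of_forall_pos_le_add fun ε hε => ?_
  rw [cdf_eq_real, add_assoc]
  refine le_trans (measureReal_mono fun t ht => ?_) (key (s + ε) (by linarith))
  exact lt_of_le_of_lt ht (lt_add_of_pos_right s hε)

end pure

/-! ### Necessary conditions: no head start, no positive stage-1 bid -/

section equilibrium

variable {σ τ : Strategy} {x y : Bid1}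

/-- The head start inequalities at a pair of matching information sets on the path. -/
lemma IsBestResponse.headStart (h : IsBestResponse σ τ) (h' : IsBestResponse τ σ)
    (hσ : (σ.first : Measure Bid1) = Measure.dirac x)
    (hτ : (τ.first : Measure Bid1) = Measure.dirac y) (hyx : y ≤ x) {r : Rank}
    (hr : rankProb x y r ≠ 0) :
    ((x : ℝ) - y) * (payoff (τ.totalLaw y (!r)) (σ.totalLaw x r) + y) = 0 ∧
    ((x : ℝ) - y) * (payoff (σ.totalLaw x r) (τ.totalLaw y (!r)) + x -
      cdf (τ.totalLaw y (!r)) x) = 0 ∧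
    (∀ s ∈ Set.Ico (x : ℝ) (y + 1),
      cdf (τ.totalLaw y (!r)) s = payoff (σ.totalLaw x r) (τ.totalLaw y (!r)) + s) ∧
    (∀ s ∈ Set.Ico (x : ℝ) (y + 1),
      cdf (σ.totalLaw x r) s = payoff (τ.totalLaw y (!r)) (σ.totalLaw x r) + s) ∧
    (∀ s ∈ Set.Ico (y : ℝ) x, cdf (τ.totalLaw y (!r)) s = cdf (τ.totalLaw y (!r)) x) := by
  have hr' : rankProb y x (!r) ≠ 0 := by rwa [rankProb_swap]
  obtain ⟨c₁, h₁⟩ := h.second_stage hσ hτ hr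
  obtain ⟨c₂, h₂⟩ := h'.second_stage hτ hσ hr'
  rw [Bool.not_not] at h₂
  exact headStart_tight _ _ hyx (x.2.2.trans (by linarith [y.2.1])) (le_totalLaw σ x r)
    (le_totalLaw τ y (!r)) (integrable_of_lintegral_ne_top (totalLaw_nonneg _ _ _) c₁)
    (integrable_of_lintegral_ne_top (totalLaw_nonneg _ _ _) c₂) (payoff_add_swap _ _) h₁ h₂

/-- Ex ante, a best response yields a nonnegative payoff. -/
lemma IsBestResponse.payoff_nonneg (h : IsBestResponse σ τ)
    (hσ : (σ.first : Measure Bid1) = Measure.dirac x)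
    (hτ : (τ.first : Measure Bid1) = Measure.dirac y) :
    0 ≤ ∑ r : Rank, (rankProb x y r).toReal * payoff (σ.totalLaw x r) (τ.totalLaw y (!r)) := by
  obtain ⟨hfin, hle⟩ := h.expect_cost_le hσ hτ
  have hwin := expect_win_pure_ne_top hσ hτ
  have := ENNReal.toReal_mono hwin hle
  rw [expect_win_pure hσ hτ] at this hwin
  rw [expect_own_pure hσ hτ ENNReal.measurable_ofReal] at this hfin
  rw [ENNReal.toReal_sum (ENNReal.sum_ne_top.1 hwin),
    ENNReal.toReal_sum (ENNReal.sum_ne_top.1 hfin), ← sub_nonneg, ← Finset.sum_sub_distrib] at this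
  refine this.trans (le_of_eq (Finset.sum_congr rfl fun r _ => ?_))
  rw [payoff, integral_eq_toReal_lintegral (totalLaw_nonneg σ x r), ENNReal.toReal_mul,
    ENNReal.toReal_mul, mul_sub]

/-- A linear distribution function on an interval has intercept bounded by its right end. -/
lemma intercept_le {Q : Measure ℝ} {a w v : ℝ} (haw : a < w)
    (h : ∀ s ∈ Set.Ico a w, cdf Q s = v + s) : v + w ≤ 1 := by
  refine le_of_forall_lt fun z hz => ?_
  obtain ⟨s, hs, hsw⟩ := exists_between (max_lt (sub_lt_iff_lt_add'.2 hz) haw)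
  have := cdf_le_one Q s
  rw [h s ⟨((le_max_right _ _).trans_lt hs).le, hsw⟩] at this
  linarith [(le_max_left _ _).trans_lt hs]

/-- If both players choose the same stage-1 bid, it is zero, and total bids are uniform. -/
theorem IsBestResponse.eq_zero_of_tie (h : IsBestResponse σ τ) (h' : IsBestResponse τ σ)
    (hσ : (σ.first : Measure Bid1) = Measure.dirac x)
    (hτ : (τ.first : Measure Bid1) = Measure.dirac x) :
    x = 0 ∧ ∀ r, σ.totalLaw 0 r = uniform 0 1 := by
  have hp : ∀ r, rankProb x x r ≠ 0 := fun r => by simp [rankProb_self]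
  have value : ∀ r, payoff (σ.totalLaw x r) (τ.totalLaw x (!r)) = -x ∧
      ∀ s ∈ Set.Ico (x : ℝ) (x + 1), cdf (σ.totalLaw x r) s = s - x := by
    intro r
    obtain ⟨-, -, h₁, h₂, -⟩ := h.headStart h' hσ hτ le_rfl (hp r)
    have hx : (x : ℝ) ∈ Set.Ico (x : ℝ) (x + 1) := ⟨le_rfl, lt_add_one _⟩
    -- Staying at most one up to `x + 1` bounds each payoff above by `-x`; being nonnegative at `x`
    -- bounds it below by `-x`.
    have u₁ := intercept_le (lt_add_one _) h₁
    have u₂ := intercept_le (lt_add_one _) h₂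
    have l₁ := cdf_nonneg (τ.totalLaw x (!r)) x
    have l₂ := cdf_nonneg (σ.totalLaw x r) x
    rw [h₁ x hx] at l₁
    rw [h₂ x hx] at l₂
    refine ⟨by linarith, fun s hs => ?_⟩
    rw [h₂ s hs]
    linarith
  have hx0 : x = 0 := by
    have := h.payoff_nonneg hσ hτ
    simp only [rankProb_self, (value _).1, Fintype.sum_bool, ENNReal.toReal_inv,
      ENNReal.toReal_ofNat] at this
    exact Subtype.ext (le_antisymm (by simpa using (by linarith : (x : ℝ) ≤ 0)) x.2.1)
  subst hx0
  refine ⟨rfl, fun r => eq_uniform_of_cdf _ (totalLaw_nonneg σ 0 r) fun s hs => ?_⟩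
  simpa using (value r).2 s (by simpa using hs)

/-- A deterministic head start is impossible: the favourite would rather bid zero in stage 1. -/
theorem IsBestResponse.not_lt (h : IsBestResponse σ τ) (h' : IsBestResponse τ σ)
    (hσ : (σ.first : Measure Bid1) = Measure.dirac x)
    (hτ : (τ.first : Measure Bid1) = Measure.dirac y) : ¬ y < x := by
  intro hyx
  have hyx' : (y : ℝ) < x := hyx
  have pt : rankProb x y true = 1 := by simp [rankProb, hyx, hyx.ne']
  have pf : rankProb x y false = 0 := by simp [rankProb, hyx, hyx.ne']
  have qf : rankProb y x false = 1 := by rw [← pt, ← rankProb_swap]; rfl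
  have qt : rankProb y x true = 0 := by rw [← pf, ← rankProb_swap]; rfl
  obtain ⟨e₁, e₂, h₁, -, h₃⟩ := h.headStart h' hσ hτ hyx.le (r := true) (by simp [pt])
  have v₁ := h.payoff_nonneg hσ hτ
  have v₂ := h'.payoff_nonneg hτ hσ
  simp only [Fintype.sum_bool, pt, pf, qt, qf, ENNReal.toReal_one, ENNReal.toReal_zero, one_mul,
    zero_mul, add_zero, zero_add, Bool.not_true, Bool.not_false] at v₁ v₂ e₁ e₂ h₁ h₃
  have hd : (x : ℝ) - y ≠ 0 := by linarith
  have e₁' := (mul_eq_zero.1 e₁).resolve_left hd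
  have e₂' := (mul_eq_zero.1 e₂).resolve_left hd
  -- The trailing player is ranked second for sure, so his ex ante payoff is `-y`, and it must be
  -- nonnegative.
  have hy0 : y = 0 := by
    have hle : (y : ℝ) ≤ 0 := by linarith
    exact Subtype.ext (le_antisymm (by simpa using hle) y.2.1)
  subst hy0
  simp only [Set.Icc.coe_zero, zero_add, sub_zero] at *
  have hv : payoff (σ.totalLaw x true) (τ.totalLaw 0 false) = 0 := by
    refine le_antisymm ?_ v₁
    -- For `x = 1` the interval `[x, 1)` carrying the linear formula is empty; the tight inequality
    -- at `x` takes its place.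
    rcases x.2.2.lt_or_eq with hx1 | hx1
    · linarith [intercept_le hx1 h₁]
    · linarith [cdf_le_one (τ.totalLaw 0 false) x]
  -- The distribution function is constant on `[0, x)` with its value at `x`, so the trailing
  -- player's law has an atom of mass `x` at zero.
  have hQ0 : (τ.totalLaw 0 false).real (Set.Iic 0) = x := by
    rw [← cdf_eq_real, h₃ 0 ⟨le_rfl, hyx'⟩]; linarith
  -- the deviation: bid zero in stage 1, and then `x / 2` after being ranked first
  set c : Bid2 := ⟨x / 2, by linarith⟩ with hc
  let κ : Rank → Measure Bid2 := fun r => Measure.dirac (if r = true then c else 0)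
  have hκt : (κ true).map (total 0) = Measure.dirac ((x : ℝ) / 2) := by
    rw [Measure.map_dirac' (measurable_total 0)]
    congr 1
    exact zero_add _
  have hκf : (κ false).map (total 0) = Measure.dirac 0 := by
    rw [Measure.map_dirac' (measurable_total 0)]
    simp [total]
  have hdev := (h.pure_deviation hσ hτ 0 κ (fun _ => inferInstance) (by
    intro r
    cases r
    · simp [hκf]
    · rw [hκt, lintegral_dirac]
      exact ENNReal.mul_ne_top (rankProb_ne_top _ _ _) ENNReal.ofReal_ne_top)).2
  have hC := (h.second_stage hσ hτ (r := true) (by simp [pt])).1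
  rw [expect_own_pure hσ hτ ENNReal.measurable_ofReal, expect_win_pure hσ hτ] at hdev
  simp only [Fintype.sum_bool, pt, pf, one_mul, zero_mul, add_zero, rankProb_self, hκt, hκf,
    lintegral_dirac, ENNReal.ofReal_zero, mul_zero, Bool.not_true, prizeProb_dirac] at hdev
  -- Any prize won after being ranked second is discarded. The deviation still earns at least `(x -
  -- x/2)/2 = x/4 > 0`, while the leader's equilibrium payoff is zero.
  have hdev' := le_trans (add_le_add_left (le_trans (mul_le_mul_right
    (le_lintegral_winProb ((x : ℝ) / 2) (τ.totalLaw 0 false)) _) le_self_add) _) hdev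
  have hdr := ENNReal.toReal_mono (ENNReal.add_ne_top.2 ⟨prizeProb_ne_top _ _,
    ENNReal.mul_ne_top (by simp) ENNReal.ofReal_ne_top⟩) hdev'
  rw [ENNReal.toReal_add (ENNReal.mul_ne_top (by simp) (measure_ne_top _ _)) hC,
    ENNReal.toReal_add (prizeProb_ne_top _ _) (ENNReal.mul_ne_top (by simp) ENNReal.ofReal_ne_top),
    ENNReal.toReal_mul, ENNReal.toReal_mul, ENNReal.toReal_ofReal (by linarith),
    ENNReal.toReal_inv, ENNReal.toReal_ofNat,
    ← integral_eq_toReal_lintegral (totalLaw_nonneg σ x true), ← measureReal_def] at hdr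
  have hmono : (τ.totalLaw 0 false).real (Set.Iic 0) ≤ (τ.totalLaw 0 false).real
      (Set.Iio ((x : ℝ) / 2)) :=
    measureReal_mono fun t ht => lt_of_le_of_lt (Set.mem_Iic.1 ht) (by linarith)
  rw [payoff] at hv
  linarith

end equilibrium

/-! ### The cheapest signal assessment and its sequential rationality -/

section cheapest

/-- The uniform law on `(0,1]` used to randomize stage-2 bids. -/
noncomputable def seed : Measure ℝ := volume.restrict (Set.Ioc 0 1)

instance : IsProbabilityMeasure seed := ⟨by simp [seed]⟩

lemma seed_Iic (s : ℝ) : seed (Set.Iic s) = ENNReal.ofReal (min 1 s) := by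
  rw [seed, Measure.restrict_apply measurableSet_Iic, Set.inter_comm, Set.Ioc_inter_Iic,
    Real.volume_Ioc, sub_zero]

lemma seed_Iio (s : ℝ) : seed (Set.Iio s) = ENNReal.ofReal (min 1 s) := by
  rw [← seed_Iic, seed, Measure.restrict_apply measurableSet_Iic,
    Measure.restrict_apply measurableSet_Iio]
  exact measure_congr (Iio_ae_eq_Iic.inter (ae_eq_refl _))

lemma ae_seed : ∀ᵐ u ∂seed, u ∈ Set.Ioc (0 : ℝ) 1 := ae_restrict_mem measurableSet_Ioc

/-- The stage-2 bid of the cheapest signal strategy at the information set `(b, r)`, as a function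
of a uniform variable `u`; a player who bid `1` and is ranked second bids `ε`. -/
noncomputable def cheapestBid (ε : ℝ≥0) (p : (Bid1 × Rank) × ℝ) : Bid2 :=
  if p.1.2 = true then (max (p.1.1 : ℝ) p.2 - p.1.1).toNNReal
  else if p.1.1 < 1 then ((1 - (p.1.1 : ℝ)) * p.2).toNNReal else ε

lemma measurable_cheapestBid (ε : ℝ≥0) : Measurable (cheapestBid ε) := by
  unfold cheapestBid
  refine Measurable.ite (measurable_fst.snd (measurableSet_singleton true)) (by fun_prop) ?_
  exact Measurable.ite (measurable_fst.fst measurableSet_Iio) (by fun_prop) measurable_const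

/-- The cheapest signal strategy. -/
noncomputable def cheapestStrategy (ε : ℝ≥0) : Strategy where
  first := ⟨Measure.dirac 0, inferInstance⟩
  second :=
    { toFun := fun p => seed.map fun u => cheapestBid ε (p, u)
      measurable' := by
        refine Measure.measurable_of_measurable_coe _ fun s hs => ?_
        have : ∀ p, (seed.map fun u => cheapestBid ε (p, u)) s =
            seed (Prod.mk p ⁻¹' (cheapestBid ε ⁻¹' s)) := fun p =>
          Measure.map_apply ((measurable_cheapestBid ε).comp measurable_prodMk_left) hs
        simp_rw [this]
        exact measurable_measure_prodMk_left (measurable_cheapestBid ε hs) }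
  isMarkov := ⟨fun p => Measure.isProbabilityMeasure_map
    ((measurable_cheapestBid ε).comp measurable_prodMk_left).aemeasurable⟩

variable (ε : ℝ≥0) (b : Bid1)

lemma cheapestStrategy_first :
    ((cheapestStrategy ε).first : Measure Bid1) = Measure.dirac 0 := rfl

lemma cheapestStrategy_totalLaw (r : Rank) :
    (cheapestStrategy ε).totalLaw b r = seed.map fun u => total b (cheapestBid ε ((b, r), u)) :=
  Measure.map_map (measurable_total b)
    ((measurable_cheapestBid ε).comp measurable_prodMk_left)

lemma cheapestStrategy_totalLaw_true :
    (cheapestStrategy ε).totalLaw b true = seed.map fun u => max (b : ℝ) u := by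
  rw [cheapestStrategy_totalLaw]
  congr 1
  ext u
  simp [cheapestBid, total]

lemma cheapestStrategy_totalLaw_false (hb : b < 1) :
    (cheapestStrategy ε).totalLaw b false = seed.map fun u => b + (1 - (b : ℝ)) * u := by
  rw [cheapestStrategy_totalLaw]
  refine Measure.map_congr ?_
  filter_upwards [ae_seed] with u hu
  have : 0 ≤ (1 - (b : ℝ)) * u := mul_nonneg (sub_nonneg.2 b.2.2) hu.1.le
  simp [cheapestBid, total, hb, this]

/-- On path the rank does not affect the total bid, so deviating in stage 1 cannot influence the law
a player faces. -/
lemma cheapestStrategy_totalLaw_zero (r : Rank) : (cheapestStrategy ε).totalLaw 0 r = seed := by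
  cases r
  · rw [cheapestStrategy_totalLaw_false ε 0 (by exact zero_lt_one)]
    simp
  · rw [cheapestStrategy_totalLaw_true]
    conv_rhs => rw [← Measure.map_id (μ := seed)]
    refine Measure.map_congr ?_
    filter_upwards [ae_seed] with u hu
    simpa using hu.1.le

/-- Moving all the mass below `b` to an atom at `b` leaves the distribution function unchanged from
`b` on. -/
lemma map_max_seed_Iic {s : ℝ} (hs : b ≤ s) :
    (seed.map fun u => max (b : ℝ) u) (Set.Iic s) = ENNReal.ofReal (min 1 s) := by
  rw [Measure.map_apply (by fun_prop) measurableSet_Iic, ← seed_Iic]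
  congr 1
  ext u
  simp [hs]

lemma map_max_seed_Iio {s : ℝ} (hs : b < s) :
    (seed.map fun u => max (b : ℝ) u) (Set.Iio s) = ENNReal.ofReal (min 1 s) := by
  rw [Measure.map_apply (by fun_prop) measurableSet_Iio, ← seed_Iio]
  congr 1
  ext u
  simp [hs]

lemma uniform_apply_Iic (a s : ℝ) :
    uniform a 1 (Set.Iic s) = (ENNReal.ofReal (1 - a))⁻¹ * ENNReal.ofReal (min 1 s - a) := by
  rw [uniform, ProbabilityTheory.cond_apply measurableSet_Ioc, Set.Ioc_inter_Iic, Real.volume_Ioc,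
    Real.volume_Ioc]

lemma isCheapestSignalStrategy_cheapestStrategy : IsCheapestSignalStrategy (cheapestStrategy ε) where
  first_eq := rfl
  total_first b := by
    refine Measure.ext_of_Iic _ _ fun s => ?_
    rw [cheapestStrategy_totalLaw_true, Measure.add_apply, Measure.smul_apply, Measure.smul_apply,
      Measure.dirac_apply' _ measurableSet_Iic, smul_eq_mul, smul_eq_mul]
    have hb0 : 0 ≤ (b : ℝ) := b.2.1
    have hmass : ENNReal.ofReal (1 - b) * uniform b 1 (Set.Iic s) =
        ENNReal.ofReal (min 1 s - b) := by
      rcases b.2.2.lt_or_eq with hb | hb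
      · rw [uniform_apply_Iic, ← mul_assoc, ENNReal.mul_inv_cancel, one_mul]
        · simpa using hb
        · exact ENNReal.ofReal_ne_top
      · rw [hb, sub_self, ENNReal.ofReal_zero, zero_mul, ENNReal.ofReal_of_nonpos]
        linarith [min_le_left 1 s]
    rw [hmass]
    rcases le_or_gt (b : ℝ) s with hs | hs
    · rw [map_max_seed_Iic b hs, Set.indicator_of_mem (by exact hs), Pi.one_apply, mul_one,
        ← ENNReal.ofReal_add hb0 (sub_nonneg.2 (le_min b.2.2 hs))]
      congr 1
      ring
    · rw [Measure.map_apply (by fun_prop) measurableSet_Iic, Set.indicator_of_notMem (by simpa),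
        mul_zero, ENNReal.ofReal_of_nonpos (by linarith [min_le_right 1 s])]
      have : (fun u => max (b : ℝ) u) ⁻¹' Set.Iic s = ∅ := by
        ext u
        simp [hs]
      simp [this]
  total_second b hb := by
    have hb' : 0 < 1 - (b : ℝ) := sub_pos.2 hb
    refine Measure.ext_of_Iic _ _ fun s => ?_
    rw [cheapestStrategy_totalLaw_false ε b hb, uniform_apply_Iic,
      Measure.map_apply (by fun_prop) measurableSet_Iic]
    have : (fun u => b + (1 - (b : ℝ)) * u) ⁻¹' Set.Iic s = Set.Iic ((s - b) / (1 - b)) := by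
      ext u
      rw [Set.mem_preimage, Set.mem_Iic, Set.mem_Iic, le_div_iff₀ hb', mul_comm u]
      constructor <;> intro h <;> linarith
    rw [this, seed_Iic, ← ENNReal.ofReal_inv_of_pos hb', ← ENNReal.ofReal_mul (inv_nonneg.2 hb'.le),
      inv_mul_eq_div, ← min_sub_sub_right, ← min_div_div_right hb'.le, div_self hb'.ne']

/-- Against an opponent whose total bid is uniform above `b`, a total bid wins with at most its
own probability. -/
lemma lintegral_winProb_cheapest_true_le {s : ℝ} (hs : b ≤ s) :
    ∫⁻ t, winProb s t ∂(cheapestStrategy ε).totalLaw b true ≤ ENNReal.ofReal s := by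
  refine (lintegral_winProb_le s _).trans ?_
  rw [cheapestStrategy_totalLaw_true, map_max_seed_Iic b hs]
  exact ENNReal.ofReal_le_ofReal (min_le_right _ _)

/-- The strict inequality `b < s` avoids the opponent's atom at `b`, where a tie would win only half
of its mass. -/
lemma le_lintegral_winProb_cheapest_true {s : ℝ} (hs : b < s) (hs1 : s ≤ 1) :
    ENNReal.ofReal s ≤ ∫⁻ t, winProb s t ∂(cheapestStrategy ε).totalLaw b true := by
  refine le_trans ?_ (le_lintegral_winProb s _)
  rw [cheapestStrategy_totalLaw_true, map_max_seed_Iio b hs, min_eq_right hs1]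

lemma lintegral_winProb_seed_le (s : ℝ) : ∫⁻ t, winProb s t ∂seed ≤ ENNReal.ofReal s := by
  refine (lintegral_winProb_le s _).trans ?_
  rw [seed_Iic]
  exact ENNReal.ofReal_le_ofReal (min_le_right _ _)

lemma le_lintegral_winProb_seed {s : ℝ} (hs1 : s ≤ 1) :
    ENNReal.ofReal s ≤ ∫⁻ t, winProb s t ∂seed := by
  refine le_trans ?_ (le_lintegral_winProb s _)
  rw [seed_Iio, min_eq_right hs1]

/-- No strategy has a positive payoff against the cheapest signal strategy, which itself has
payoff zero. -/
lemma isBestResponse_cheapestStrategy (ε ε' : ℝ≥0) :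
    IsBestResponse (cheapestStrategy ε) (cheapestStrategy ε') := by
  intro σ
  have hσ : expect σ (cheapestStrategy ε') (fun x c y d => winProb (total x c) (total y d)) ≤
      expect σ (cheapestStrategy ε') (fun x c _ _ => ENNReal.ofReal (total x c)) := by
    rw [expect, expect, cheapestStrategy_first]
    simp only [lintegral_dirac]
    refine lintegral_mono fun x => Finset.sum_le_sum fun r _ =>
      mul_le_mul_right (lintegral_mono fun c => ?_) _
    rw [lintegral_winProb_total, cheapestStrategy_totalLaw_zero, lintegral_const, measure_univ,
      mul_one]
    exact lintegral_winProb_seed_le _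
  have hfst := cheapestStrategy_first ε
  have hfst' := cheapestStrategy_first ε'
  have hwin := expect_win_pure_ne_top hfst hfst'
  have hle : expect (cheapestStrategy ε) (cheapestStrategy ε')
        (fun x c _ _ => ENNReal.ofReal (total x c)) ≤
      expect (cheapestStrategy ε) (cheapestStrategy ε')
        (fun x c y d => winProb (total x c) (total y d)) := by
    rw [expect_win_pure hfst hfst', expect_own_pure hfst hfst' ENNReal.measurable_ofReal]
    refine Finset.sum_le_sum fun r _ => mul_le_mul_right ?_ _
    rw [cheapestStrategy_totalLaw_zero, cheapestStrategy_totalLaw_zero]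
    refine lintegral_mono_ae ?_
    filter_upwards [ae_seed] with s hs
    exact le_lintegral_winProb_seed hs.2
  unfold utility
  -- A deviation of infinite expected cost has utility `-∞`.
  by_cases hc : expect σ (cheapestStrategy ε') (fun x c _ _ => ENNReal.ofReal (total x c)) = ⊤
  · rw [hc, EReal.coe_ennreal_top, EReal.sub_top]
    exact bot_le
  · rw [coe_sub_le_coe_sub_iff hc (ne_top_of_le_ne_top hc hσ) hwin]
    exact ⟨ne_top_of_le_ne_top hwin hle, by rw [add_comm]; exact add_le_add hle hσ⟩

/-- If, against the opponent's law at `y`, total bids win with at most their own probability, then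
stage-2 laws concentrated on total bids attaining this bound are optimal. -/
lemma continuationUtility_le {τ : Strategy} {ν : ProbabilityMeasure Bid1} {y b : Bid1} {r : Rank}
    (hν : (ν : Measure Bid1) = Measure.dirac y) {κ ρ : ProbabilityMeasure Bid2}
    (hle : ∀ s, (b : ℝ) ≤ s → ∫⁻ t, winProb s t ∂τ.totalLaw y (!r) ≤ ENNReal.ofReal s)
    (hκ : ∀ᵐ c ∂(κ : Measure Bid2), ENNReal.ofReal (total b c) ≤
      ∫⁻ t, winProb (total b c) t ∂τ.totalLaw y (!r)) :
    continuationUtility τ ν b r ρ ≤ continuationUtility τ ν b r κ := by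
  have htot : ∀ π : ProbabilityMeasure Bid2, ∫⁻ c, ENNReal.ofReal (total b c) ∂(π : Measure Bid2) =
      ENNReal.ofReal b + ∫⁻ c, (c : ℝ≥0∞) ∂(π : Measure Bid2) := by
    intro π
    have : ∀ c : Bid2, ENNReal.ofReal (total b c) = ENNReal.ofReal b + (c : ℝ≥0∞) := by
      intro c
      change ENNReal.ofReal ((b : ℝ) + (c : ℝ)) = _
      rw [ENNReal.ofReal_add b.2.1 (NNReal.coe_nonneg c)]
      congr 1
      exact ENNReal.ofReal_coe_nnreal
    simp_rw [this]
    rw [lintegral_add_left measurable_const]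
    simp
  have hwin : ∀ π : ProbabilityMeasure Bid2, ∫⁻ c, ∫⁻ t, winProb (total b c) t ∂τ.totalLaw y (!r)
      ∂(π : Measure Bid2) ≠ ⊤ := by
    intro π
    refine ne_top_of_le_ne_top ENNReal.one_ne_top ?_
    calc _ ≤ ∫⁻ _, 1 ∂(π : Measure Bid2) :=
          lintegral_mono fun c => (lintegral_winProb_le _ _).trans prob_le_one
      _ = 1 := by simp
  have hρ := lintegral_mono (μ := (ρ : Measure Bid2))
    fun c => hle (total b c) (le_add_of_nonneg_right c.2)
  have hκ' := lintegral_mono_ae hκ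
  rw [htot] at hρ hκ'
  unfold continuationUtility
  rw [hν]
  simp only [lintegral_dirac, lintegral_winProb_total]
  by_cases hc : ∫⁻ c, (c : ℝ≥0∞) ∂(ρ : Measure Bid2) = ⊤
  · rw [hc, EReal.coe_ennreal_top, EReal.sub_top]
    exact bot_le
  · rw [coe_sub_le_coe_sub_iff hc (hwin ρ) (hwin κ)]
    refine ⟨ne_top_of_le_ne_top (hwin κ) (le_add_self.trans hκ'), ?_⟩
    calc _ ≤ ENNReal.ofReal b + ∫⁻ c, (c : ℝ≥0∞) ∂(ρ : Measure Bid2) +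
          ∫⁻ c, (c : ℝ≥0∞) ∂(κ : Measure Bid2) := by gcongr
      _ = (ENNReal.ofReal b + ∫⁻ c, (c : ℝ≥0∞) ∂(κ : Measure Bid2)) +
          ∫⁻ c, (c : ℝ≥0∞) ∂(ρ : Measure Bid2) := by ring
      _ ≤ _ := by gcongr

/-- The beliefs of the cheapest signal equilibrium. -/
noncomputable def cheapestBelief : Belief := fun b r =>
  ⟨Measure.dirac (if r = true then 0 else b), inferInstance⟩

lemma isCheapestSignalBelief_cheapestBelief : IsCheapestSignalBelief cheapestBelief :=
  fun _ => ⟨rfl, rfl⟩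

/-- Against a stage-1 bid of zero, being ranked second has positive probability only at `b = 0`,
where both prescribed beliefs are `dirac 0`. -/
lemma isBayesian_cheapestBelief : IsBayesian (cheapestStrategy ε) cheapestBelief := by
  intro b r hp s hs
  rw [signalProb, cheapestStrategy_first, lintegral_dirac] at *
  have hb : (if r = true then 0 else b) = 0 := by
    cases r
    · by_contra hb
      have hb' : 0 < b := lt_of_le_of_ne b.2.1 fun h => hb (by simpa using h.symm)
      simp [rankProb, hb', hb'.ne'] at hp
    · rfl
  have : (cheapestBelief b r : Measure Bid1) = Measure.dirac 0 := by
    change Measure.dirac _ = _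
    rw [hb]
  classical
  rw [this, setLIntegral_dirac, Measure.dirac_apply' _ hs]
  by_cases h0 : (0 : Bid1) ∈ s
  · simp [h0, ENNReal.div_self hp (rankProb_ne_top _ _ _)]
  · simp [h0]

lemma ae_secondLaw_cheapest {r : Rank} {S : Set ℝ} (hS : MeasurableSet S)
    (h : ∀ᵐ u ∂seed, total b (cheapestBid ε ((b, r), u)) ∈ S) :
    ∀ᵐ c ∂((cheapestStrategy ε).secondLaw b r : Measure Bid2), total b c ∈ S :=
  (ae_map_iff ((measurable_cheapestBid ε).comp measurable_prodMk_left).aemeasurable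
    (measurable_total b hS)).2 h

/-- Sequential rationality of the cheapest signal assessment at the unexempted information sets. -/
lemma cheapest_rational {r : Rank} (hbr : ¬ (b = 1 ∧ r = false)) (ρ : ProbabilityMeasure Bid2) :
    continuationUtility (cheapestStrategy ε) (cheapestBelief b r) b r ρ ≤
      continuationUtility (cheapestStrategy ε) (cheapestBelief b r) b r
        ((cheapestStrategy ε).secondLaw b r) := by
  cases r
  · have hb : b < 1 := lt_of_le_of_ne b.2.2 fun h => hbr ⟨h, rfl⟩
    have hb' : 0 < 1 - (b : ℝ) := sub_pos.2 hb
    refine continuationUtility_le (y := b) rfl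
      (fun s hs => lintegral_winProb_cheapest_true_le ε b hs) ?_
    have := ae_secondLaw_cheapest ε b (r := false) (measurableSet_Ioc (a := (b : ℝ)) (b := 1)) (by
        filter_upwards [ae_seed] with u hu
        have h0 := mul_pos hb' hu.1
        have h1 := mul_le_mul_of_nonneg_left hu.2 hb'.le
        have : total b (cheapestBid ε ((b, false), u)) = b + (1 - (b : ℝ)) * u := by
          simp [cheapestBid, total, hb, h0.le]
        rw [this]
        exact ⟨by linarith, by linarith⟩)
    filter_upwards [this] with c hc
    exact le_lintegral_winProb_cheapest_true ε b hc.1 hc.2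
  · refine continuationUtility_le (y := 0) rfl (fun s _ => ?_) ?_
    · rw [cheapestStrategy_totalLaw_zero]
      exact lintegral_winProb_seed_le s
    · have := ae_secondLaw_cheapest ε b (r := true) (measurableSet_Iic (a := 1)) (by
          filter_upwards [ae_seed] with u hu
          simpa [cheapestBid, total] using ⟨b.2.2, hu.2⟩)
      filter_upwards [this] with c hc
      rw [cheapestStrategy_totalLaw_zero]
      exact le_lintegral_winProb_seed hc

/-- At the exempted information set the cheapest signal strategy is optimal up to `ε`. -/
lemma cheapest_rational_exempt (hε : 0 < ε) (ρ : ProbabilityMeasure Bid2) :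
    continuationUtility (cheapestStrategy ε) (cheapestBelief 1 false) 1 false ρ ≤
      continuationUtility (cheapestStrategy ε) (cheapestBelief 1 false) 1 false
        ((cheapestStrategy ε).secondLaw 1 false) + ((ε : ℝ) : EReal) := by
  have hlaw : ((cheapestStrategy ε).secondLaw 1 false : Measure Bid2) = Measure.dirac ε := by
    change (seed.map fun u => cheapestBid ε ((1, false), u)) = _
    simp [cheapestBid]
  have hν : (cheapestBelief 1 false : Measure Bid1) = Measure.dirac 1 := rfl
  unfold continuationUtility
  rw [hlaw, hν]
  simp only [lintegral_dirac, lintegral_winProb_total, Bool.not_false]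
  have hwin : ∫⁻ t, winProb (total 1 ε) t ∂(cheapestStrategy ε).totalLaw 1 true = 1 := by
    refine le_antisymm ((lintegral_winProb_le _ _).trans prob_le_one) ?_
    refine le_trans ?_ (le_lintegral_winProb _ _)
    have h1 : ((1 : Bid1) : ℝ) < total 1 ε := lt_add_of_pos_right _ hε
    rw [cheapestStrategy_totalLaw_true, map_max_seed_Iio 1 h1, min_eq_left (by exact h1.le),
      ENNReal.ofReal_one]
  have hr : ((1 : ℝ≥0∞) : EReal) - ((ε : ℝ≥0∞) : EReal) + ((ε : ℝ) : EReal) = 1 := by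
    change (((1 - (ε : ℝ)) + ε : ℝ) : EReal) = 1
    simp
  rw [hwin, hr]
  -- No continuation utility exceeds one, and bidding `ε` attains `1 - ε`.
  refine le_trans (b := ((1 : ℝ≥0∞) : EReal) - 0) ?_ (by simp)
  refine EReal.sub_le_sub (EReal.coe_ennreal_le_coe_ennreal_iff.2 ?_) (EReal.coe_ennreal_nonneg _)
  calc _ ≤ ∫⁻ _, 1 ∂(ρ : Measure Bid2) :=
        lintegral_mono fun c => (lintegral_winProb_le _ _).trans prob_le_one
    _ = 1 := by simp

end cheapest

/-! ### Consistency through exponentially tilted trembles -/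

section consistency

/-- A full-support law of stage-1 bids with atoms at both ends. -/
noncomputable def baseLaw : Measure Bid1 :=
  (gaussianReal 0 1).map (Set.projIcc (0 : ℝ) 1 zero_le_one)

/-- A full-support law of stage-2 bids. -/
noncomputable def trembleLaw : Measure Bid2 := (gaussianReal 0 1).map Real.toNNReal

instance : (gaussianReal 0 1).IsOpenPosMeasure :=
  (gaussianReal_absolutelyContinuous' 0 one_ne_zero).isOpenPosMeasure

instance : IsProbabilityMeasure baseLaw :=
  Measure.isProbabilityMeasure_map continuous_projIcc.measurable.aemeasurable

instance : baseLaw.IsOpenPosMeasure :=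
  continuous_projIcc.isOpenPosMeasure_map (Set.projIcc_surjective _)

instance : IsProbabilityMeasure trembleLaw :=
  Measure.isProbabilityMeasure_map measurable_real_toNNReal.aemeasurable

instance : trembleLaw.IsOpenPosMeasure :=
  continuous_real_toNNReal.isOpenPosMeasure_map fun c => ⟨c, Real.toNNReal_coe⟩

/-- The atoms at the ends are needed because `(0, true)` and `(1, false)` are compatible only with
an opponent's bid of exactly `0` or `1`. -/
lemma baseLaw_zero : baseLaw {0} ≠ 0 := by
  rw [baseLaw, Measure.map_apply continuous_projIcc.measurable (measurableSet_singleton _)]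
  have h : Set.Iio (0 : ℝ) ⊆ Set.projIcc (0 : ℝ) 1 zero_le_one ⁻¹' {0} := fun t ht =>
    Set.projIcc_of_le_left _ ht.le
  exact fun h0 => (isOpen_Iio.measure_pos (gaussianReal 0 1) ⟨-1, by simp⟩).ne'
    (measure_mono_null h h0)

lemma baseLaw_one : baseLaw {1} ≠ 0 := by
  rw [baseLaw, Measure.map_apply continuous_projIcc.measurable (measurableSet_singleton _)]
  have h : Set.Ioi (1 : ℝ) ⊆ Set.projIcc (0 : ℝ) 1 zero_le_one ⁻¹' {1} := fun t ht =>
    Set.projIcc_of_right_le _ ht.le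
  exact fun h0 => (isOpen_Ioi.measure_pos (gaussianReal 0 1) ⟨2, by simp⟩).ne'
    (measure_mono_null h h0)

/-- An exponential weight which, for large `n`, makes low bids overwhelmingly more likely than
higher ones. -/
noncomputable def decay (n : ℕ) (y : Bid1) : ℝ≥0∞ := ENNReal.ofReal (Real.exp (-(n * (y : ℝ))))

@[fun_prop]
lemma measurable_decay (n : ℕ) : Measurable (decay n) := by unfold decay; fun_prop

/-- The mass that the weight `w`, tilted towards low bids, gives to `A`. -/
noncomputable def tiltMass (n : ℕ) (w : Bid1 → ℝ≥0∞) (A : Set Bid1) : ℝ≥0∞ :=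
  ∫⁻ y in A, w y * decay n y ∂baseLaw

variable {n : ℕ} {w : Bid1 → ℝ≥0∞} {A : Set Bid1}

lemma tiltMass_le {c : ℝ} (h : ∀ y ∈ A, w y ≠ 0 → c ≤ y)
    (hw : ∀ y, w y ≤ 1) : tiltMass n w A ≤ ENNReal.ofReal (Real.exp (-(n * c))) := by
  calc tiltMass n w A ≤ ∫⁻ _ in A, ENNReal.ofReal (Real.exp (-(n * c))) ∂baseLaw := by
        refine setLIntegral_mono measurable_const fun y hy => ?_
        by_cases h0 : w y = 0
        · simp [h0]
        · refine (mul_le_of_le_one_left (zero_le) (hw y)).trans (ENNReal.ofReal_le_ofReal ?_)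
          have := mul_le_mul_of_nonneg_left (h y hy h0) n.cast_nonneg
          exact Real.exp_le_exp.2 (neg_le_neg this)
    _ = ENNReal.ofReal (Real.exp (-(n * c))) * baseLaw A := setLIntegral_const _ _
    _ ≤ _ := mul_le_of_le_one_right (zero_le) prob_le_one

lemma le_tiltMass (hA : MeasurableSet A) {c : ℝ} (h : ∀ y ∈ A, (y : ℝ) ≤ c) :
    ENNReal.ofReal (Real.exp (-(n * c))) * ∫⁻ y in A, w y ∂baseLaw ≤ tiltMass n w A := by
  rw [← lintegral_const_mul' _ _ ENNReal.ofReal_ne_top]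
  refine setLIntegral_mono' hA fun y hy => ?_
  rw [mul_comm]
  refine mul_le_mul_right (ENNReal.ofReal_le_ofReal (Real.exp_le_exp.2 (neg_le_neg ?_))) _
  exact mul_le_mul_of_nonneg_left (h y hy) n.cast_nonneg

lemma tiltMass_univ_ne_zero (hw : ∫⁻ y, w y ∂baseLaw ≠ 0) : tiltMass n w Set.univ ≠ 0 := by
  have h := le_tiltMass (n := n) (w := w) MeasurableSet.univ (c := 1) fun y _ => y.2.2
  rw [setLIntegral_univ] at h
  exact fun h0 => mul_ne_zero (by simpa using Real.exp_pos _) hw (le_antisymm (h.trans h0.le) zero_le)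

lemma tiltMass_ne_top (hw : ∀ y, w y ≤ 1) : tiltMass n w A ≠ ⊤ := by
  refine ne_top_of_le_ne_top (tiltMass_le (n := n) (A := Set.univ) (c := 0)
    (fun y _ _ => y.2.1) hw |>.trans_lt ENNReal.ofReal_lt_top).ne ?_
  exact lintegral_mono_set (Set.subset_univ A)

/-- The tilted weight concentrates at the lowest bid of positive weight. -/
lemma tendsto_tiltMass_compl (hw : ∀ y, w y ≤ 1) {y₀ : Bid1} (hlow : ∀ y < y₀, w y = 0)
    (hpos : ∀ G : Set Bid1, IsOpen G → y₀ ∈ G → ∫⁻ y in G, w y ∂baseLaw ≠ 0)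
    {G : Set Bid1} (hG : IsOpen G) (hy : y₀ ∈ G) :
    Tendsto (fun n => tiltMass n w Gᶜ / tiltMass n w Set.univ) atTop (𝓝 0) := by
  obtain ⟨d, hd, hball⟩ := Metric.isOpen_iff.1 hG y₀ hy
  -- Half the radius separates the exponential rates: outside `G` the weight decays at rate at least
  -- `y₀ + d`, while the smaller ball keeps mass at rate at most `y₀ + d / 2`.
  set k := ∫⁻ y in Metric.ball y₀ (d / 2), w y ∂baseLaw
  have hk : k ≠ 0 := hpos _ Metric.isOpen_ball (Metric.mem_ball_self (half_pos hd))
  have hbound : ∀ n : ℕ, tiltMass n w Gᶜ / tiltMass n w Set.univ ≤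
      ENNReal.ofReal (Real.exp (-(n * (d / 2)))) / k := by
    intro n
    have hnum : tiltMass n w Gᶜ ≤ ENNReal.ofReal (Real.exp (-(n * ((y₀ : ℝ) + d)))) := by
      refine tiltMass_le (fun y hyG hwy => ?_) hw
      have hle : y₀ ≤ y := not_lt.1 fun h => hwy (hlow y h)
      have hle' : (y₀ : ℝ) ≤ y := hle
      have hdist : d ≤ dist y y₀ := not_lt.1 fun h => hyG (hball h)
      rw [Subtype.dist_eq, Real.dist_eq, abs_of_nonneg (sub_nonneg.2 hle')] at hdist
      linarith
    have hden : ENNReal.ofReal (Real.exp (-(n * ((y₀ : ℝ) + d / 2)))) * k ≤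
        tiltMass n w Set.univ := by
      refine (le_tiltMass measurableSet_ball fun y hyB => ?_).trans
        (lintegral_mono_set (Set.subset_univ _))
      have := Metric.mem_ball.1 hyB
      rw [Subtype.dist_eq, Real.dist_eq] at this
      linarith [le_abs_self ((y : ℝ) - y₀)]
    refine ENNReal.div_le_of_le_mul (hnum.trans ?_)
    have hexp : Real.exp (-(n * ((y₀ : ℝ) + d))) =
        Real.exp (-(n * (d / 2))) * Real.exp (-(n * ((y₀ : ℝ) + d / 2))) := by
      rw [← Real.exp_add]
      congr 1
      ring
    have hk' : k ≠ ⊤ := by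
      refine ne_top_of_le_ne_top ENNReal.one_ne_top ?_
      calc k ≤ ∫⁻ _ in Metric.ball y₀ (d / 2), 1 ∂baseLaw := lintegral_mono hw
        _ = baseLaw (Metric.ball y₀ (d / 2)) := setLIntegral_one _
        _ ≤ 1 := prob_le_one
    calc ENNReal.ofReal (Real.exp (-(n * ((y₀ : ℝ) + d))))
        = ENNReal.ofReal (Real.exp (-(n * (d / 2)))) / k *
          (ENNReal.ofReal (Real.exp (-(n * ((y₀ : ℝ) + d / 2)))) * k) := by
          rw [hexp, ENNReal.ofReal_mul (Real.exp_pos _).le, mul_comm _ k, ← mul_assoc,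
            ENNReal.div_mul_cancel hk hk']
      _ ≤ _ := mul_le_mul_right hden _
  have hlim : Tendsto (fun n : ℕ => ENNReal.ofReal (Real.exp (-(n * (d / 2)))) / k) atTop (𝓝 0) := by
    have h1 : Tendsto (fun n : ℕ => Real.exp (-(n * (d / 2)))) atTop (𝓝 0) :=
      Real.tendsto_exp_neg_atTop_nhds_zero.comp
        (tendsto_natCast_atTop_atTop.atTop_mul_const (half_pos hd))
    have h2 := ENNReal.Tendsto.div_const (ENNReal.tendsto_ofReal h1) (b := k) (Or.inr hk)
    simpa using h2
  exact tendsto_of_tendsto_of_tendsto_of_le_of_le tendsto_const_nhds hlim (fun _ => zero_le) hbound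

/-- By the portmanteau theorem it suffices that the mass outside every open neighbourhood of `y₀`
vanishes. -/
lemma tendsto_dirac_of_tiltMass (hw : ∀ y, w y ≤ 1) {y₀ : Bid1} (hlow : ∀ y < y₀, w y = 0)
    (hpos : ∀ G : Set Bid1, IsOpen G → y₀ ∈ G → ∫⁻ y in G, w y ∂baseLaw ≠ 0)
    {π : ℕ → ProbabilityMeasure Bid1} {δ : ProbabilityMeasure Bid1}
    (hδ : (δ : Measure Bid1) = Measure.dirac y₀)
    (hπ : ∀ n A, MeasurableSet A →
      (π n : Measure Bid1) A = tiltMass n w A / tiltMass n w Set.univ) :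
    Tendsto π atTop (𝓝 δ) := by
  refine tendsto_of_forall_isOpen_le_liminf' fun G hG => ?_
  rw [hδ, Measure.dirac_apply' _ hG.measurableSet]
  by_cases hy : y₀ ∈ G
  · have h := tendsto_tiltMass_compl hw hlow hpos hG hy
    have h' : Tendsto (fun n => 1 - (π n : Measure Bid1) Gᶜ) atTop (𝓝 (1 - 0)) := by
      refine ENNReal.Tendsto.sub tendsto_const_nhds (h.congr fun n => ?_) (Or.inl ENNReal.one_ne_top)
      exact (hπ n _ hG.measurableSet.compl).symm
    rw [Set.indicator_of_mem hy, Pi.one_apply]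
    refine le_of_eq (Eq.symm (Tendsto.liminf_eq ?_))
    rw [tsub_zero] at h'
    refine h'.congr fun n => ?_
    rw [prob_compl_eq_one_sub hG.measurableSet, ENNReal.sub_sub_cancel ENNReal.one_ne_top prob_le_one]
  · rw [Set.indicator_of_notMem hy]
    exact zero_le

/-- The beliefs derived by Bayes' rule from a strategy under which all signals have positive
probability. -/
noncomputable def bayesBelief (τ : Strategy) (hτ : ∀ b r, signalProb τ b r ≠ 0) : Belief :=
  fun b r => ⟨(signalProb τ b r)⁻¹ • (τ.first : Measure Bid1).withDensity (rankProb b · r), ⟨by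
    rw [Measure.smul_apply, withDensity_apply _ MeasurableSet.univ, setLIntegral_univ, smul_eq_mul]
    refine ENNReal.inv_mul_cancel (hτ b r) (ne_top_of_le_ne_top ENNReal.one_ne_top ?_)
    calc signalProb τ b r ≤ ∫⁻ _, 1 ∂(τ.first : Measure Bid1) :=
          lintegral_mono fun y => rankProb_le_one b y r
      _ = 1 := by simp⟩⟩

lemma bayesBelief_apply (τ : Strategy) (hτ : ∀ b r, signalProb τ b r ≠ 0) (b : Bid1) (r : Rank)
    {s : Set Bid1} (hs : MeasurableSet s) :
    (bayesBelief τ hτ b r : Measure Bid1) s =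
      (∫⁻ y in s, rankProb b y r ∂(τ.first : Measure Bid1)) / signalProb τ b r := by
  change ((signalProb τ b r)⁻¹ • (τ.first : Measure Bid1).withDensity (rankProb b · r)) s = _
  rw [Measure.smul_apply, withDensity_apply _ hs, smul_eq_mul, mul_comm, div_eq_mul_inv]

/-- The weight of the tremble in stage 2. -/
noncomputable def trembleWeight (n : ℕ) : ℝ≥0∞ := ((n : ℝ≥0∞) + 1)⁻¹

lemma trembleWeight_le_one (n : ℕ) : trembleWeight n ≤ 1 := by
  simp [trembleWeight]

lemma trembleWeight_ne_zero (n : ℕ) : trembleWeight n ≠ 0 := by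
  simp [trembleWeight]

lemma tendsto_trembleWeight : Tendsto trembleWeight atTop (𝓝 0) := by
  have := (tendsto_add_atTop_iff_nat 1).2 ENNReal.tendsto_inv_nat_nhds_zero
  exact this.congr fun n => by simp [trembleWeight]

/-- A completely mixed perturbation of `σ` in stage 2 with exponentially decaying stage-1 bids. -/
noncomputable def perturbed (σ : Strategy) (n : ℕ) : Strategy where
  first := ⟨(tiltMass n 1 Set.univ)⁻¹ • baseLaw.withDensity (decay n), ⟨by
    rw [Measure.smul_apply, withDensity_apply _ MeasurableSet.univ, smul_eq_mul]
    simp only [tiltMass, Pi.one_apply, one_mul]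
    have h0 := tiltMass_univ_ne_zero (n := n) (w := 1) (by simp)
    have h1 := tiltMass_ne_top (n := n) (w := 1) (A := Set.univ) (fun _ => le_rfl)
    simp only [tiltMass, Pi.one_apply, one_mul] at h0 h1
    exact ENNReal.inv_mul_cancel h0 h1⟩⟩
  second :=
    { toFun := fun p => (1 - trembleWeight n) • σ.second p + trembleWeight n • trembleLaw
      measurable' := by
        refine Measure.measurable_of_measurable_coe _ fun s hs => ?_
        simp only [Measure.add_apply, Measure.smul_apply, smul_eq_mul]
        exact ((Kernel.measurable_coe σ.second hs).const_mul _).add_const _ }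
  isMarkov := ⟨fun p => ⟨by
    change ((1 - trembleWeight n) • σ.second p + trembleWeight n • trembleLaw) Set.univ = 1
    simp [tsub_add_cancel_of_le (trembleWeight_le_one n)]⟩⟩

variable (σ : Strategy)

lemma perturbed_first (n : ℕ) : ((perturbed σ n).first : Measure Bid1) =
    (tiltMass n 1 Set.univ)⁻¹ • baseLaw.withDensity (decay n) := rfl

lemma perturbed_second (n : ℕ) (p : Bid1 × Rank) : (perturbed σ n).second p =
    (1 - trembleWeight n) • σ.second p + trembleWeight n • trembleLaw := rfl

lemma lintegral_perturbed_first (hw : Measurable w) (hA : MeasurableSet A) :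
    ∫⁻ y in A, w y ∂((perturbed σ n).first : Measure Bid1) =
      (tiltMass n 1 Set.univ)⁻¹ * tiltMass n w A := by
  rw [perturbed_first, Measure.restrict_smul, lintegral_smul_measure, smul_eq_mul,
    restrict_withDensity hA, lintegral_withDensity_eq_lintegral_mul _ (measurable_decay n) hw]
  simp only [tiltMass, Pi.mul_apply, mul_comm]

lemma lintegral_rankProb_true_ne_zero (b : Bid1) (G : Set Bid1) (h0 : 0 ∈ G) :
    ∫⁻ y in G, rankProb b y true ∂baseLaw ≠ 0 := by
  have hpos : rankProb b 0 true ≠ 0 := by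
    rcases eq_or_lt_of_le (show 0 ≤ b from b.2.1) with h | h
    · simp [← h, rankProb_self]
    · simp [rankProb, h, h.ne']
  have h : rankProb b 0 true * baseLaw {0} ≤ ∫⁻ y in G, rankProb b y true ∂baseLaw := by
    rw [← lintegral_singleton (rankProb _ · _)]
    exact lintegral_mono_set (by simpa using h0)
  exact fun hz => mul_ne_zero hpos baseLaw_zero (le_antisymm (h.trans hz.le) zero_le)

lemma lintegral_rankProb_false_ne_zero (b : Bid1) (G : Set Bid1) (hG : IsOpen G) (hb : b ∈ G) :
    ∫⁻ y in G, rankProb b y false ∂baseLaw ≠ 0 := by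
  rcases eq_or_lt_of_le (show b ≤ 1 from b.2.2) with h | h
  · subst h
    have h : rankProb 1 1 false * baseLaw {1} ≤ ∫⁻ y in G, rankProb 1 y false ∂baseLaw := by
      rw [← lintegral_singleton (rankProb _ · _)]
      exact lintegral_mono_set (by simpa using hb)
    exact fun hz => mul_ne_zero (by simp [rankProb_self]) baseLaw_one
      (le_antisymm (h.trans hz.le) zero_le)
  -- For `b < 1` no atom is needed: part of `G` lies strictly above `b`, where being ranked second
  -- is certain.
  · have := nhdsGT_neBot_of_exists_gt ⟨1, h⟩
    obtain ⟨z, hzG, hzb⟩ := (this.nonempty_of_mem (inter_mem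
      (mem_nhdsWithin_of_mem_nhds (hG.mem_nhds hb)) self_mem_nhdsWithin))
    have hop : IsOpen (G ∩ Set.Ioi b) := hG.inter isOpen_Ioi
    have hle : baseLaw (G ∩ Set.Ioi b) ≤ ∫⁻ y in G, rankProb b y false ∂baseLaw := by
      rw [← setLIntegral_one]
      refine le_trans (setLIntegral_mono' hop.measurableSet fun y hy => ?_)
        (lintegral_mono_set Set.inter_subset_left)
      have hby : b < y := hy.2
      simp [rankProb, hby.ne, hby.not_gt]
    exact fun hz => (hop.measure_pos baseLaw ⟨z, hzG, hzb⟩).ne'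
      (le_antisymm (hle.trans hz.le) zero_le)

lemma lintegral_rankProb_ne_zero (b : Bid1) (r : Rank) : ∫⁻ y, rankProb b y r ∂baseLaw ≠ 0 := by
  rw [← setLIntegral_univ]
  cases r
  · exact lintegral_rankProb_false_ne_zero b _ isOpen_univ trivial
  · exact lintegral_rankProb_true_ne_zero b _ trivial

lemma tiltMass_one_inv_ne_zero (n : ℕ) : (tiltMass n 1 Set.univ)⁻¹ ≠ 0 :=
  ENNReal.inv_ne_zero.2 (tiltMass_ne_top fun _ => le_rfl)

lemma tiltMass_one_inv_ne_top (n : ℕ) : (tiltMass n 1 Set.univ)⁻¹ ≠ ⊤ :=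
  ENNReal.inv_ne_top.2 (tiltMass_univ_ne_zero (by simp))

lemma signalProb_perturbed (n : ℕ) (b : Bid1) (r : Rank) : signalProb (perturbed σ n) b r =
    (tiltMass n 1 Set.univ)⁻¹ * tiltMass n (rankProb b · r) Set.univ := by
  rw [signalProb, ← setLIntegral_univ,
    lintegral_perturbed_first σ (measurable_rankProb b r) MeasurableSet.univ]

lemma perturbed_isCompletelyMixed (n : ℕ) : (perturbed σ n).IsCompletelyMixed where
  first_pos U hU hne := by
    have h := lintegral_perturbed_first σ (n := n) (w := 1) measurable_const hU.measurableSet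
    simp only [Pi.one_apply, setLIntegral_one] at h
    rw [h]
    refine mul_ne_zero (tiltMass_one_inv_ne_zero n) fun h0 => ?_
    have hle := le_tiltMass (n := n) (w := 1) hU.measurableSet (c := 1) fun y _ => y.2.2
    simp only [Pi.one_apply, setLIntegral_one, h0] at hle
    exact mul_ne_zero (by simpa using Real.exp_pos _) (hU.measure_pos baseLaw hne).ne'
      (le_antisymm hle zero_le)
  second_pos b r U hU hne := by
    rw [perturbed_second, Measure.add_apply, Measure.smul_apply, Measure.smul_apply, smul_eq_mul,
      smul_eq_mul]
    have := mul_ne_zero (trembleWeight_ne_zero n) (hU.measure_pos trembleLaw hne).ne'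
    simp only [ne_eq, add_eq_zero, not_and]
    exact fun _ => this
  signal_pos b r := by
    rw [signalProb_perturbed]
    exact mul_ne_zero (tiltMass_one_inv_ne_zero n)
      (tiltMass_univ_ne_zero (lintegral_rankProb_ne_zero b r))

lemma tendsto_perturbed_secondLaw (b : Bid1) (r : Rank) :
    Tendsto (fun n => (perturbed σ n).secondLaw b r) atTop (𝓝 (σ.secondLaw b r)) := by
  refine tendsto_of_forall_isOpen_le_liminf' fun G _ => ?_
  have h1 : Tendsto (fun n => (1 - trembleWeight n) * σ.second (b, r) G +
      trembleWeight n * trembleLaw G) atTop (𝓝 ((1 - 0) * σ.second (b, r) G + 0 * trembleLaw G)) :=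
    (ENNReal.Tendsto.mul_const (ENNReal.Tendsto.sub tendsto_const_nhds tendsto_trembleWeight
      (Or.inl ENNReal.one_ne_top)) (Or.inr (measure_ne_top _ _))).add
      (ENNReal.Tendsto.mul_const tendsto_trembleWeight (Or.inr (measure_ne_top _ _)))
  rw [tsub_zero, one_mul, zero_mul, add_zero] at h1
  exact (Tendsto.liminf_eq h1).symm.le

/-- The cheapest signal beliefs are consistent with every profile of strategies that bid zero in
stage 1. -/
lemma isConsistent_cheapestBelief {β : Fin 2 → Strategy}
    (hβ : ∀ i, ((β i).first : Measure Bid1) = Measure.dirac 0) :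
    IsConsistent β fun _ => cheapestBelief := by
  refine ⟨fun n i => perturbed (β i) n, fun n i => bayesBelief (perturbed (β (opponent i)) n)
    (perturbed_isCompletelyMixed _ n).signal_pos, fun n i => perturbed_isCompletelyMixed _ n,
    fun n i b r _ s hs => bayesBelief_apply _ _ b r hs, fun i => ?_,
    fun i => tendsto_perturbed_secondLaw _, fun i b r => ?_⟩
  · refine tendsto_dirac_of_tiltMass (w := 1) (fun _ => le_rfl) (y₀ := 0)
      (fun y hy => absurd y.2.1 (not_le.2 hy)) (fun G hG h0 => ?_) (hβ i) fun n A hA => ?_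
    · simpa using (hG.measure_pos baseLaw ⟨0, h0⟩).ne'
    · have h := lintegral_perturbed_first (β i) (n := n) (w := 1) measurable_const hA
      simp only [Pi.one_apply, setLIntegral_one] at h
      rw [h, mul_comm, div_eq_mul_inv]
  · have hπ : ∀ n A, MeasurableSet A → (bayesBelief (perturbed (β (opponent i)) n)
        (perturbed_isCompletelyMixed _ n).signal_pos b r : Measure Bid1) A =
        tiltMass n (rankProb b · r) A / tiltMass n (rankProb b · r) Set.univ := by
      intro n A hA
      rw [bayesBelief_apply _ _ b r hA, signalProb_perturbed,
        lintegral_perturbed_first _ (measurable_rankProb b r) hA,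
        ENNReal.mul_div_mul_left _ _ (tiltMass_one_inv_ne_zero n) (tiltMass_one_inv_ne_top n)]
    -- The lowest bid compatible with the signal is `b` after being ranked second and `0` after
    -- being ranked first.
    cases r
    · refine tendsto_dirac_of_tiltMass (fun y => rankProb_le_one b y _) (y₀ := b)
        (fun y hy => ?_) (fun G hG hb => lintegral_rankProb_false_ne_zero b G hG hb) rfl hπ
      simp [rankProb, hy, hy.ne']
    · exact tendsto_dirac_of_tiltMass (fun y => rankProb_le_one b y _) (y₀ := 0)
        (fun y hy => absurd y.2.1 (not_le.2 hy))
        (fun G _ h0 => lintegral_rankProb_true_ne_zero b G h0) rfl hπ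

end consistency

/-! ### Assembly of the two halves -/

lemma opponent_opponent (i : Fin 2) : opponent (opponent i) = i := Fin.rev_rev i

/-- Pure mutual best responses bid zero in stage 1, and their total bids are uniform. -/
theorem eq_zero_and_uniform_of_isBestResponse {β : Fin 2 → Strategy}
    (h : ∀ i, IsBestResponse (β i) (β (opponent i))) (hp : ∀ i, (β i).IsPure) :
    (∀ i, ((β i).first : Measure Bid1) = Measure.dirac 0) ∧
      ∀ i r, (β i).totalLaw 0 r = uniform 0 1 := by
  choose a ha using hp
  have h' : ∀ i, IsBestResponse (β (opponent i)) (β i) := fun i => by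
    simpa only [opponent_opponent] using h (opponent i)
  have hle : ∀ i, a i ≤ a (opponent i) := fun i => not_lt.1 ((h i).not_lt (h' i) (ha _) (ha _))
  have heq : ∀ i, a (opponent i) = a i := fun i =>
    le_antisymm (by simpa only [opponent_opponent] using hle (opponent i)) (hle i)
  have key : ∀ i, a i = 0 ∧ ∀ r, (β i).totalLaw 0 r = uniform 0 1 := fun i =>
    (h i).eq_zero_of_tie (h' i) (ha i) (by rw [ha, heq])
  exact ⟨fun i => by rw [ha, (key i).1], fun i => (key i).2⟩

end RankAuction

theorem mainTheorem4 :
    -- every pure-strategy sequential equilibrium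
    (∀ (β : Fin 2 → RankAuction.Strategy) (μ : Fin 2 → RankAuction.Belief),
      RankAuction.IsSequentialEquilibrium β μ → (∀ i, (β i).IsPure) →
        -- both players bid 0 in stage 1
        (∀ i, ((β i).first : MeasureTheory.Measure RankAuction.Bid1) =
          MeasureTheory.Measure.dirac 0) ∧
        -- the total bid of each player is uniform on (0,1], unconditionally ...
        (∀ i, ∀ s : Set ℝ, MeasurableSet s →
          RankAuction.totalBidProb (β i) (β (RankAuction.opponent i)) s =
            RankAuction.uniform 0 1 s) ∧
        -- ... and at each of the two information sets on the path
        (∀ i r, (β i).totalLaw 0 r = RankAuction.uniform 0 1)) ∧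
    -- existence, with rationality up to any ε > 0 at the one exempted information set
    (∀ ε : ℝ, 0 < ε →
      ∃ (β : Fin 2 → RankAuction.Strategy) (μ : Fin 2 → RankAuction.Belief),
        RankAuction.IsSequentialEquilibrium β μ ∧
        (∀ i, (β i).IsPure) ∧
        (∀ i, RankAuction.IsCheapestSignalStrategy (β i)) ∧
        (∀ i, RankAuction.IsCheapestSignalBelief (μ i)) ∧
        (∀ i, RankAuction.IsRationalAt β μ ε i 1 false)) := by
  refine ⟨fun β μ hβ hp => ?_, fun ε hε => ?_⟩
  · obtain ⟨h0, hU⟩ := RankAuction.eq_zero_and_uniform_of_isBestResponse hβ.rational_initial hp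
    refine ⟨h0, fun i s hs => ?_, hU⟩
    have := RankAuction.expect_own_pure (h0 i) (h0 (RankAuction.opponent i))
      (g := s.indicator 1) (measurable_one.indicator hs)
    rw [RankAuction.totalBidProb, this]
    simp only [hU, lintegral_indicator_one hs, RankAuction.rankProb_self, Fintype.sum_bool]
    rw [← add_mul, ENNReal.inv_two_add_inv_two, one_mul]
  · lift ε to ℝ≥0 using hε.le
    refine ⟨fun _ => RankAuction.cheapestStrategy ε, fun _ => RankAuction.cheapestBelief,
      ⟨fun _ => RankAuction.isBestResponse_cheapestStrategy ε ε, fun _ b r hbr ρ => ?_,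
        fun _ => RankAuction.isBayesian_cheapestBelief ε,
        RankAuction.isConsistent_cheapestBelief fun _ => rfl⟩,
      fun _ => ⟨0, rfl⟩, fun _ => RankAuction.isCheapestSignalStrategy_cheapestStrategy ε,
      fun _ => RankAuction.isCheapestSignalBelief_cheapestBelief,
      fun _ => RankAuction.cheapest_rational_exempt ε (by exact_mod_cast hε)⟩
    rw [EReal.coe_zero, add_zero]
    exact RankAuction.cheapest_rational ε b hbr ρ
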